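/- Let $K\ge 2$ and $N>0$ be coprime integers. A *filtered bundle* $\mathcal E$ of rank $K$ on $(\mathbb{CP}^1,\{\infty\})$ is a locally free $\mathcal O(*\infty)$-module of rank $K$ (where $\mathcal O(*\infty)$ is the sheaf of functions with poles only at $\infty$) with an increasing right-continuous filtration by locally free $\mathcal O$-submodules $(\mathcal P_\alpha\mathcal E)_{\alpha\in\mathbb R}$ that agree with $\mathcal E$ away from $\infty$ and satisfy $\mathcal P_{\alpha-1}\mathcal E=z^{-1}\mathcal P_\alpha\mathcal E$ near $\infty$; put $\nu_\infty(s)=\inf\{\alpha: s\in\mathcal P_\alpha\}$. For $\alpha\in\mathbb R$, $\mathcal O(\alpha)$ is $\mathcal O(*\infty)$ filtered by pole order at $\infty$ shifted by $-\alpha$, so that its section $1$ has $\nu_\infty=-\alpha$. An $SL(K)$-structure is a section $\omega$ of $\bigwedge^K\mathcal E$ trivializing it away from $\infty$ with $\nu_\infty(\omega)=0$. Let $\mathcal C_{K,N}$ be the category of filtered $SL(K)$-bundles $\mathcal E$ with a traceless meromorphic Higgs field $\varphi\in \mathrm{End}\,\mathcal E\otimes K_{\mathbb{CP}^1}$, holomorphic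 away from $\infty$, such that after pullback by $\psi(u)=u^{2K}=z^{-1}$ (the pulled back filtration being normalized by $\nu(\psi^*s)=2K\,\nu_\infty(s)$) there is near $u=0$ a decomposition of $\psi^*\mathcal E$ into $\psi^*\varphi$-invariant filtered line bundles $\mathcal L_1,\dots,\mathcal L_K$, each isomorphic to the trivial line bundle filtered by pole order at $u=0$, with $\psi^*\varphi|_{\mathcal L_r}-d\mathfrak a_r$ having at most a simple pole, where $\mathfrak a_r=\frac{K}{K+N}e^{2\pi i r/K}u^{-2(N+K)}$. Morphisms are isomorphisms of filtered bundles preserving the Higgs fields. Let $\mathcal M_{K,N}$ be the set of isomorphism classes. For $t\in\mathbb C$ put $\rho_t(z)=e^{-Kt/(K+N)}z$; the $\mathbb C^\times$-action on $\mathcal M_{K,N}$ is $[(\mathcal E,\varphi)]\mapsto[(\rho_t^*\mathcal E,e^t\rho_t^*\varphi)]$, $t\in\mathbb C/2\pi i(K+N)\mathbb Z$. A *cyclic $K$-partition of $N$* is a class $[\mathbf b]$ of tuples $\mathbf b=(b_1,\dots,b_K)\in\mathbb Z_{\ge0}^K$ with $\sum_i b_i=N$, up to cyclic permutation of the indices.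 For such $\mathbf b$ let $\alpha_1,\dots,\alpha_K\in\mathbb R$ be determined by $\alpha_i-\alpha_{i+1}=b_i-\frac NK$ (indices mod $K$) and $\sum_i\alpha_i=0$, and set $$\mathcal E_{\mathbf b}=\bigoplus_{i=1}^K\mathcal O(\alpha_i),\qquad \varphi_{\mathbf b}=\begin{pmatrix}0&z^{b_1}&&\\&&\ddots&\\&&&z^{b_{K-1}}\\z^{b_K}&&&\end{pmatrix}dz .$$ The stratum $\mathcal M_{K,N}^{[\mathbf b]}\subset\mathcal M_{K,N}$ consists of the classes $[(\mathcal E,\varphi)]$ with $\mathcal E\simeq\mathcal E_{\mathbf b}$ as filtered bundles. **Proposition.** The map $[\mathbf b]\mapsto[(\mathcal E_{\mathbf b},\varphi_{\mathbf b})]$ is well defined and is a bijection from the set of cyclic $K$-partitions of $N$ onto the set of $\mathbb C^\times$-fixed points in $\mathcal M_{K,N}$. Consequently the set of fixed points is finite, and each stratum $\mathcal M_{K,N}^{[\mathbf b]}$ contains exactly one fixed point, namely $[(\mathcal E_{\mathbf b},\varphi_{\mathbf b})]$. -/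

import Mathlib

open Filter Topology Polynomial TensorProduct

namespace WildHiggs

noncomputable section

/-! ### Germs of meromorphic functions -/

/-- Germs along the punctured neighbourhoods of `0 ∈ ℂ` of functions meromorphic at `0`. -/
def merSubring : Subring (Germ (𝓝[≠] (0 : ℂ)) ℂ) where
  carrier := {g | ∃ f : ℂ → ℂ, MeromorphicAt f 0 ∧ (f : Germ (𝓝[≠] (0 : ℂ)) ℂ) = g}
  mul_mem' := by
    rintro _ _ ⟨f, hf, rfl⟩ ⟨g, hg, rfl⟩
    exact ⟨f * g, hf.mul hg, rfl⟩
  one_mem' := ⟨fun _ => 1, MeromorphicAt.const 1 0, rfl⟩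
  add_mem' := by
    rintro _ _ ⟨f, hf, rfl⟩ ⟨g, hg, rfl⟩
    exact ⟨f + g, hf.add hg, rfl⟩
  zero_mem' := ⟨fun _ => 0, MeromorphicAt.const 0 0, rfl⟩
  neg_mem' := by
    rintro _ ⟨f, hf, rfl⟩
    exact ⟨-f, hf.neg, rfl⟩

/-- The field of germs at `0` of meromorphic functions of one complex variable. -/
def Mer : Type := merSubring

namespace Mer

instance : CommRing Mer := inferInstanceAs (CommRing merSubring)

/-- The germ of a meromorphic function. -/
def mk (f : ℂ → ℂ) (hf : MeromorphicAt f 0) : Mer := ⟨(f : Germ (𝓝[≠] (0 : ℂ)) ℂ), f, hf, rfl⟩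

theorem mk_eq_mk {f g : ℂ → ℂ} (hf : MeromorphicAt f 0) (hg : MeromorphicAt g 0) :
    mk f hf = mk g hg ↔ f =ᶠ[𝓝[≠] 0] g :=
  Subtype.ext_iff.trans Germ.coe_eq

theorem exists_rep (a : Mer) : ∃ f, ∃ hf : MeromorphicAt f 0, mk f hf = a := by
  obtain ⟨_, f, hf, rfl⟩ := a
  exact ⟨f, hf, rfl⟩

instance : Inv Mer :=
  ⟨fun a => ⟨a.1⁻¹, by
    obtain ⟨_, f, hf, rfl⟩ := a
    exact ⟨f⁻¹, hf.inv, rfl⟩⟩⟩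

instance : Nontrivial Mer := inferInstanceAs (Nontrivial merSubring)

instance : Field Mer where
  inv := Inv.inv
  mul_inv_cancel := by
    intro a ha
    obtain ⟨f, hf, rfl⟩ := exists_rep a
    refine (mk_eq_mk (hf.mul hf.inv) (MeromorphicAt.const 1 0)).2 ?_
    rcases hf.eventually_eq_zero_or_eventually_ne_zero with h | h
    · exact absurd ((mk_eq_mk hf (MeromorphicAt.const 0 0)).2 h) ha
    · filter_upwards [h] with x hx
      simp [hx]
  inv_zero := by
    refine (mk_eq_mk (MeromorphicAt.const (0 : ℂ) 0).inv (MeromorphicAt.const 0 0)).2 ?_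
    exact Eventually.of_forall fun x => by simp
  nnqsmul := _
  qsmul := _

/-- Constant germs. -/
def const : ℂ →+* Mer where
  toFun c := mk (fun _ => c) (MeromorphicAt.const c 0)
  map_one' := rfl
  map_mul' _ _ := rfl
  map_zero' := rfl
  map_add' _ _ := rfl

/-- The germ of the coordinate function. -/
def coord : Mer := mk (fun x => x) (MeromorphicAt.id 0)

theorem coord_ne_zero : coord ≠ 0 := by
  intro h
  have h' := (mk_eq_mk (MeromorphicAt.id 0) (MeromorphicAt.const 0 0)).1 h
  have h2 : ∀ᶠ x : ℂ in 𝓝[≠] 0, x ≠ 0 := eventually_mem_nhdsWithin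
  obtain ⟨x, hx, hx'⟩ := (h'.and h2).exists
  exact hx' hx

/-- The ring of germs of holomorphic functions. -/
def Hol : Subring Mer where
  carrier := {a | ∃ f, ∃ hf : AnalyticAt ℂ f 0, mk f hf.meromorphicAt = a}
  mul_mem' := by
    rintro _ _ ⟨f, hf, rfl⟩ ⟨g, hg, rfl⟩
    exact ⟨f * g, hf.mul hg, rfl⟩
  one_mem' := ⟨fun _ => 1, analyticAt_const, rfl⟩
  add_mem' := by
    rintro _ _ ⟨f, hf, rfl⟩ ⟨g, hg, rfl⟩
    exact ⟨f + g, hf.add hg, rfl⟩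
  zero_mem' := ⟨fun _ => 0, analyticAt_const, rfl⟩
  neg_mem' := by
    rintro _ ⟨f, hf, rfl⟩
    exact ⟨-f, hf.neg, rfl⟩

/-- The germ `a` has a pole of order at most `β` (equivalently at most `⌊β⌋`) at `0`; a negative
`β` imposes a zero. -/
def PoleLE (a : Mer) (β : ℝ) : Prop := coord ^ ⌊β⌋ * a ∈ Hol

/-- Pullback of germs along a holomorphic map fixing `0`, and only `0`, near `0`. -/
def pull (h : ℂ → ℂ) (ha : AnalyticAt ℂ h 0) (h0 : h 0 = 0)
    (ht : Tendsto h (𝓝[≠] 0) (𝓝[≠] 0)) : Mer →+* Mer where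
  toFun a := ⟨a.1.compTendsto h ht, by
    obtain ⟨_, f, hf, rfl⟩ := a
    exact ⟨f ∘ h, MeromorphicAt.comp_analyticAt (by rwa [h0]) ha, rfl⟩⟩
  map_one' := rfl
  map_mul' := by
    rintro ⟨_, f, hf, rfl⟩ ⟨_, g, hg, rfl⟩
    rfl
  map_zero' := rfl
  map_add' := by
    rintro ⟨_, f, hf, rfl⟩ ⟨_, g, hg, rfl⟩
    rfl

theorem tendsto_mul (a : ℂˣ) : Tendsto (fun x : ℂ => a * x) (𝓝[≠] 0) (𝓝[≠] 0) := by
  refine tendsto_nhdsWithin_of_tendsto_nhds_of_eventually_within _ ?_ ?_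
  · have : Continuous fun x : ℂ => (a : ℂ) * x := by fun_prop
    simpa using (this.tendsto 0).mono_left nhdsWithin_le_nhds
  · filter_upwards [eventually_mem_nhdsWithin] with x hx
    simpa using hx

theorem tendsto_pow (m : ℕ) [NeZero m] :
    Tendsto (fun u : ℂ => u ^ m) (𝓝[≠] 0) (𝓝[≠] 0) := by
  refine tendsto_nhdsWithin_of_tendsto_nhds_of_eventually_within _ ?_ ?_
  · have : Continuous fun x : ℂ => x ^ m := by fun_prop
    simpa [NeZero.ne m] using (this.tendsto 0).mono_left nhdsWithin_le_nhds
  · filter_upwards [eventually_mem_nhdsWithin] with x hx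
    exact pow_ne_zero m hx

/-- The substitution `f(x) ↦ f(a x)`. -/
def rot (a : ℂˣ) : Mer →+* Mer :=
  pull (fun x => a * x) (by fun_prop) (by simp) (tendsto_mul a)

/-- The substitution `f(x) ↦ f(u ^ m)`. -/
def powPull (m : ℕ) [NeZero m] : Mer →+* Mer :=
  pull (fun u => u ^ m) (by fun_prop) (by simp [NeZero.ne m]) (tendsto_pow m)

theorem rot_rot (a b : ℂˣ) (f : Mer) : rot a (rot b f) = rot (b * a) f := by
  obtain ⟨f, hf, rfl⟩ := exists_rep f
  refine Subtype.ext (Germ.coe_eq.2 (Eventually.of_forall fun x => ?_))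
  simp [mul_assoc]

theorem rot_one (f : Mer) : rot 1 f = f := by
  obtain ⟨f, hf, rfl⟩ := exists_rep f
  refine Subtype.ext (Germ.coe_eq.2 (Eventually.of_forall fun x => ?_))
  simp

theorem rot_const (a : ℂˣ) (c : ℂ) : rot a (const c) = const c := rfl

theorem rot_coord (a : ℂˣ) : rot a coord = const a * coord := rfl

theorem rot_mem_hol (a : ℂˣ) {f : Mer} (hf : f ∈ Hol) : rot a f ∈ Hol := by
  obtain ⟨f, hf, rfl⟩ := hf
  refine ⟨fun x => f (a * x), ?_, rfl⟩
  have h : AnalyticAt ℂ (fun x : ℂ => (a : ℂ) * x) 0 := by fun_prop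
  exact AnalyticAt.fun_comp (by simpa using hf) h

theorem coord_mem_hol : coord ∈ Hol := ⟨fun x => x, analyticAt_id, rfl⟩

theorem const_mem_hol (c : ℂ) : const c ∈ Hol := ⟨fun _ => c, analyticAt_const, rfl⟩

end Mer

open Mer

/-- Polynomials in the affine coordinate `z` of `ℂℙ¹`, seen as germs of meromorphic functions
at `z = ∞` in the coordinate `x = 1 / z`. -/
instance : Algebra ℂ[X] Mer := (Polynomial.eval₂RingHom Mer.const Mer.coord⁻¹).toAlgebra

theorem algebraMap_poly (f : ℂ[X]) :
    algebraMap ℂ[X] Mer f = f.eval₂ Mer.const Mer.coord⁻¹ := rfl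

theorem hol_smul {M : Type} [AddCommGroup M] [Module ℂ[X] M] (f : Hol) (v : Mer ⊗[ℂ[X]] M) :
    f • v = (f : Mer) • v := rfl

/-! ### Filtered bundles -/

/-- A filtered rank `K` bundle `ℰ` on `(ℂℙ¹, {∞})`.

A locally free `𝒪(*∞)`-module is given by its module `Sec` of global sections, a finite
projective module over `Γ(ℂℙ¹, 𝒪(*∞)) = ℂ[z]`; its stalk at `∞` is `Mer ⊗ Sec`, where
`Mer` is the stalk of `𝒪(*∞)` (meromorphic germs in `x = 1 / z`). As `𝒫_α ℰ` agrees with `ℰ`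
away from `∞`, it is given by its stalk `filt α` at `∞`, a free module over the holomorphic germs
which has a basis that is also a basis of the stalk of `ℰ`. -/
structure FilteredBundle (K : ℕ) where
  Sec : Type
  [grp : AddCommGroup Sec]
  [mod : Module ℂ[X] Sec]
  [fin : Module.Finite ℂ[X] Sec]
  [proj : Module.Projective ℂ[X] Sec]
  rank_eq : Module.finrank ℂ[X] Sec = K
  filt : ℝ → Submodule Hol (Mer ⊗[ℂ[X]] Sec)
  lattice : ∀ α, ∃ b : Module.Basis (Fin K) Mer (Mer ⊗[ℂ[X]] Sec),
    filt α = Submodule.span Hol (Set.range b)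
  mono : Monotone filt
  right_cont : ∀ α, filt α = ⨅ β > α, filt β
  shift : ∀ α v, v ∈ filt (α - 1) ↔ ∃ w ∈ filt α, v = Mer.coord • w

attribute [instance] FilteredBundle.grp FilteredBundle.mod FilteredBundle.fin FilteredBundle.proj

/-- The stalk at `∞` of a filtered bundle. -/
abbrev FilteredBundle.Stalk {K : ℕ} (E : FilteredBundle K) : Type := Mer ⊗[ℂ[X]] E.Sec

/-- `g : E → F` is an isomorphism of filtered bundles. -/
def IsFilteredIso {K : ℕ} {E F : FilteredBundle K} (g : E.Sec ≃ₗ[ℂ[X]] F.Sec) : Prop :=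
  ∀ (α : ℝ) (v : E.Stalk), v ∈ E.filt α ↔ g.toLinearMap.baseChange Mer v ∈ F.filt α

/-- A filtered bundle on `(ℂℙ¹, {∞})` with a Higgs field `φ`, a meromorphic section of
`End ℰ ⊗ K_{ℂℙ¹}` holomorphic away from `∞`, written as `φ = phi dz`. -/
structure FilteredHiggs (K : ℕ) extends FilteredBundle K where
  phi : Sec →ₗ[ℂ[X]] Sec

/-- Two filtered Higgs bundles are isomorphic: there is an isomorphism of filtered bundles
preserving the Higgs fields. -/
def HiggsIso {K : ℕ} (E F : FilteredHiggs K) : Prop :=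
  ∃ g : E.Sec ≃ₗ[ℂ[X]] F.Sec,
    IsFilteredIso (E := E.toFilteredBundle) (F := F.toFilteredBundle) g ∧
      ∀ s, g (E.phi s) = F.phi (g s)

theorem IsFilteredIso.refl {K : ℕ} (E : FilteredBundle K) :
    IsFilteredIso (LinearEquiv.refl ℂ[X] E.Sec) := by
  intro α v
  simp

theorem IsFilteredIso.symm {K : ℕ} {E F : FilteredBundle K} {g : E.Sec ≃ₗ[ℂ[X]] F.Sec}
    (h : IsFilteredIso g) : IsFilteredIso g.symm := by
  intro α v
  rw [h α, ← LinearMap.comp_apply, ← LinearMap.baseChange_comp]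
  simp

theorem IsFilteredIso.trans {K : ℕ} {E F G : FilteredBundle K} {g : E.Sec ≃ₗ[ℂ[X]] F.Sec}
    {h : F.Sec ≃ₗ[ℂ[X]] G.Sec} (hg : IsFilteredIso g) (hh : IsFilteredIso h) :
    IsFilteredIso (g.trans h) := by
  intro α v
  rw [hg α, hh α, ← LinearMap.comp_apply, ← LinearMap.baseChange_comp]
  rfl

instance higgsSetoid (K : ℕ) : Setoid (FilteredHiggs K) where
  r := HiggsIso
  iseqv :=
    { refl := fun E => ⟨LinearEquiv.refl _ _, IsFilteredIso.refl _, fun _ => rfl⟩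
      symm := by
        rintro E F ⟨g, hg, h⟩
        refine ⟨g.symm, hg.symm, fun s => ?_⟩
        rw [LinearEquiv.symm_apply_eq, h, LinearEquiv.apply_symm_apply]
      trans := by
        rintro E F G ⟨g, hg, h⟩ ⟨g', hg', h'⟩
        refine ⟨g.trans g', hg.trans hg', fun s => ?_⟩
        simp [h, h'] }

/-- Isomorphism classes of filtered Higgs bundles of rank `K`. -/
abbrev HiggsClass (K : ℕ) : Type 1 := Quotient (higgsSetoid K)

/-! ### `SL(K)`-structures -/

/-- The germ at `∞` of a section of `⋀^K ℰ`. -/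
def wedgeGerm {K : ℕ} (E : FilteredBundle K) :
    ⋀[ℂ[X]]^K E.Sec →ₗ[ℂ[X]] ⋀[Mer]^K E.Stalk :=
  exteriorPower.alternatingMapLinearEquiv
    { toFun := fun s => exteriorPower.ιMulti Mer K fun i => (1 : Mer) ⊗ₜ[ℂ[X]] s i
      map_update_add' := by
        intro _ m i x y
        have key : ∀ w : E.Sec, (fun j => (1 : Mer) ⊗ₜ[ℂ[X]] Function.update m i w j) =
            Function.update (fun j => (1 : Mer) ⊗ₜ[ℂ[X]] m j) i (1 ⊗ₜ w) := fun w => by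
          ext j
          by_cases hj : j = i
          · subst hj; simp
          · simp [hj]
        simp only [key, TensorProduct.tmul_add, AlternatingMap.map_update_add]
      map_update_smul' := by
        intro _ m i c x
        have key : ∀ w : E.Sec, (fun j => (1 : Mer) ⊗ₜ[ℂ[X]] Function.update m i w j) =
            Function.update (fun j => (1 : Mer) ⊗ₜ[ℂ[X]] m j) i (1 ⊗ₜ w) := fun w => by
          ext j
          by_cases hj : j = i
          · subst hj; simp
          · simp [hj]
        have hc : (1 : Mer) ⊗ₜ[ℂ[X]] (c • x) = algebraMap ℂ[X] Mer c • ((1 : Mer) ⊗ₜ[ℂ[X]] x) := by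
          rw [TensorProduct.tmul_smul, algebraMap_smul]
        simp only [key, hc]
        rw [AlternatingMap.map_update_smul, algebraMap_smul]
      map_eq_zero_of_eq' := by
        intro v i j h hij
        exact AlternatingMap.map_eq_zero_of_eq _ _ (by simp [h]) hij }

/-- The filtration of the stalk at `∞` of `⋀^K ℰ` induced by the one of `ℰ`. -/
def wedgeFilt {K : ℕ} (E : FilteredBundle K) (α : ℝ) : Submodule Hol (⋀[Mer]^K E.Stalk) :=
  Submodule.span Hol {w | ∃ (s : Fin K → E.Stalk) (β : Fin K → ℝ),
    (∀ i, s i ∈ E.filt (β i)) ∧ ∑ i, β i = α ∧ w = exteriorPower.ιMulti Mer K s}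

/-- The order `ν_∞(ω)` at `∞` of a section of `⋀^K ℰ`. -/
def wedgeOrder {K : ℕ} (E : FilteredBundle K) (ω : ⋀[ℂ[X]]^K E.Sec) : EReal :=
  sInf {a | ∃ α : ℝ, wedgeGerm E ω ∈ wedgeFilt E α ∧ a = α}

/-- An `SL(K)`-structure: a section `ω` of `⋀^K ℰ` trivializing it away from `∞`,
with `ν_∞(ω) = 0`. -/
structure SLStructure {K : ℕ} (E : FilteredBundle K) where
  ω : ⋀[ℂ[X]]^K E.Sec
  trivializes : Submodule.span ℂ[X] {ω} = ⊤
  order_eq : wedgeOrder E ω = 0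

/-! ### The irregular singularity at `∞` -/

/-- The field `Mer`, for germs in a coordinate `u` on an `m`-fold cover `ψ(u) = u ^ m = x` of a disc
with coordinate `x`. -/
def Cover (_ : ℕ) : Type := Mer

instance (m : ℕ) : Field (Cover m) := inferInstanceAs (Field Mer)

/-- Germs downstairs act on germs upstairs through the pullback `ψ^* f = f(u ^ m)`. -/
instance (m : ℕ) [NeZero m] : Algebra Mer (Cover m) :=
  RingHom.toAlgebra (S := Cover m) (Mer.powPull m)

/-- Holomorphic germs in `u`. -/
def HolCover (m : ℕ) : Subring (Cover m) := Hol

/-- The coordinate `u`. -/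
def uCoord (m : ℕ) : Cover m := Mer.coord

/-- Constants as germs in `u`. -/
def uConst (m : ℕ) : ℂ →+* Cover m := Mer.const

/-- The pullback `ψ^* ℰ`, as a space of germs at `u = 0` of meromorphic sections. -/
abbrev PullStalk (m : ℕ) [NeZero m] {K : ℕ} (E : FilteredBundle K) : Type :=
  Cover m ⊗[Mer] E.Stalk

/-- The filtration on `ψ^* ℰ`: the one generated by the pulled back sections, where
`ν(ψ^* s) = m ν_∞(s)`. -/
def pullFilt (m : ℕ) [NeZero m] {K : ℕ} (E : FilteredBundle K) (β : ℝ) :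
    Submodule (HolCover m) (PullStalk m E) :=
  Submodule.span (HolCover m) {w | ∃ (k : ℤ) (α : ℝ) (s : E.Stalk),
    s ∈ E.filt α ∧ m * α + k ≤ β ∧ w = ((uCoord m) ^ (-k) : Cover m) ⊗ₜ[Mer] s}

/-- `ψ^* phi`, so that `ψ^* φ = (ψ^* phi) dz`. -/
def pullPhi (m : ℕ) [NeZero m] {K : ℕ} (E : FilteredHiggs K) :
    PullStalk m E.toFilteredBundle →ₗ[Cover m] PullStalk m E.toFilteredBundle :=
  (E.phi.baseChange Mer).baseChange (Cover m)

/-- `dz / du`, where `z = 1 / x = u ^ (-2K)`. -/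
def dzdu (K : ℕ) : Cover (2 * K) :=
  uConst (2 * K) (-2 * K) * uCoord (2 * K) ^ (-(2 * K + 1) : ℤ)

/-- `d𝔞_r / du` for the singular type `𝔞_r = K / (K + N) * exp (2πi r / K) * u ^ (-2(N + K))`. -/
def dSingularType (K N : ℕ) (r : ℕ) : Cover (2 * K) :=
  uConst (2 * K) (-2 * K * Complex.exp (2 * Real.pi * Complex.I * r / K)) *
    uCoord (2 * K) ^ (-(2 * (N + K) + 1) : ℤ)

/-- The condition at `∞` on the objects of `𝒞_{K,N}`: after pullback along `u ↦ u ^ (2K) = x`, there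
is near `u = 0` a decomposition of `ψ^* ℰ` into filtered line bundles, the `r`-th spanned by a
section `f r` and filtered by pole order at `u = 0`, such that `ψ^* φ` preserves it and acts on the
`r`-th summand as `lam r dz`, where `lam r dz - d𝔞_r` is logarithmic (`r = 1, …, K`). -/
def IsGoodAtInfinity (K N : ℕ) [NeZero K] (E : FilteredHiggs K) : Prop :=
  ∃ (f : Module.Basis (Fin K) (Cover (2 * K)) (PullStalk (2 * K) E.toFilteredBundle))
    (lam : Fin K → Cover (2 * K)),
    (∀ (β : ℝ) (v : PullStalk (2 * K) E.toFilteredBundle),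
      v ∈ pullFilt (2 * K) E.toFilteredBundle β ↔ ∀ r, Mer.PoleLE (f.repr v r) β) ∧
    (∀ r, pullPhi (2 * K) E (f r) = lam r • f r) ∧
    ∀ r : Fin K, Mer.PoleLE (lam r * dzdu K - dSingularType K N (r + 1)) 1

/-- The objects of the category `𝒞_{K,N}`: good filtered `SL(K)`-Higgs bundles on `(ℂℙ¹, {∞})`
with the prescribed singularity. -/
structure CObject (K N : ℕ) [NeZero K] extends FilteredHiggs K where
  sl : SLStructure toFilteredBundle
  traceless : LinearMap.trace ℂ[X] Sec phi = 0
  good : IsGoodAtInfinity K N toFilteredHiggs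

/-- The set `ℳ_{K,N}` of isomorphism classes of objects of `𝒞_{K,N}`. -/
def moduli (K N : ℕ) [NeZero K] : Set (HiggsClass K) :=
  {q | ∃ E : CObject K N, (⟦E.toFilteredHiggs⟧ : HiggsClass K) = q}

/-! ### The `ℂ^×`-action -/

/-- The substitution `f(z) ↦ f(a z)`. -/
def polyRot (a : ℂˣ) : ℂ[X] →+* ℂ[X] := Polynomial.compRingHom (C (a : ℂ) * X)

theorem polyRot_polyRot (a b : ℂˣ) (f : ℂ[X]) : polyRot a (polyRot b f) = polyRot (b * a) f := by
  simp [polyRot, Polynomial.comp_assoc, mul_assoc]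

theorem polyRot_one (f : ℂ[X]) : polyRot 1 f = f := by simp [polyRot]

/-- `polyRot` as an automorphism. -/
def polyRotEquiv (a : ℂˣ) : ℂ[X] ≃+* ℂ[X] :=
  RingEquiv.ofRingHom (polyRot a) (polyRot a⁻¹)
    (RingHom.ext fun f => by simp [polyRot_polyRot, polyRot_one])
    (RingHom.ext fun f => by simp [polyRot_polyRot, polyRot_one])

theorem rot_algebraMap (a : ℂˣ) (f : ℂ[X]) :
    Mer.rot a⁻¹ (algebraMap ℂ[X] Mer f) = algebraMap ℂ[X] Mer (polyRot a f) := by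
  have h : (Mer.rot a⁻¹).comp (algebraMap ℂ[X] Mer) = (algebraMap ℂ[X] Mer).comp (polyRot a) := by
    refine Polynomial.ringHom_ext (fun c => ?_) ?_
    · simp [algebraMap_poly, polyRot, Mer.rot_const]
    · simp only [algebraMap_poly, polyRot, RingHom.comp_apply, Polynomial.eval₂_X, map_inv₀,
        Mer.rot_coord, Polynomial.coe_compRingHom_apply, Polynomial.X_comp, Polynomial.eval₂_mul,
        Polynomial.eval₂_C, mul_inv, Units.val_inv_eq_inv_val, inv_inv]
  exact RingHom.congr_fun h f

/-- A semilinear equivalence transports bases. -/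
def semiBasis {R S V W ι : Type*} [CommRing R] [CommRing S] [AddCommGroup V] [AddCommGroup W]
    [Module R V] [Module S W] (σ : R ≃+* S) (e : V ≃+ W) (he : ∀ r v, e (r • v) = σ r • e v)
    (b : Module.Basis ι R V) : Module.Basis ι S W :=
  .ofRepr
    { toFun := fun w => (b.repr (e.symm w)).mapRange σ (map_zero σ)
      invFun := fun g => e (b.repr.symm (g.mapRange σ.symm (map_zero σ.symm)))
      map_add' := fun v w => by ext; simp
      map_smul' := fun r w => by
        have h : e.symm (r • w) = σ.symm r • e.symm w := by
          rw [AddEquiv.symm_apply_eq, he]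
          simp
        ext
        simp [h]
      left_inv := fun w => by
        have h : ((b.repr (e.symm w)).mapRange σ (map_zero σ)).mapRange σ.symm (map_zero σ.symm) =
            b.repr (e.symm w) := by
          ext; simp
        simp [h]
      right_inv := fun g => by ext; simp }

theorem semiBasis_apply {R S V W ι : Type*} [CommRing R] [CommRing S] [AddCommGroup V]
    [AddCommGroup W] [Module R V] [Module S W] (σ : R ≃+* S) (e : V ≃+ W)
    (he : ∀ r v, e (r • v) = σ r • e v) (b : Module.Basis ι R V) (i : ι) :
    semiBasis σ e he b i = e (b i) := by
  rw [Module.Basis.apply_eq_iff]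
  ext j
  classical
  simp only [semiBasis, LinearEquiv.coe_mk, LinearMap.coe_mk, AddHom.coe_mk,
    AddEquiv.symm_apply_apply, Module.Basis.repr_self, Finsupp.mapRange_apply,
    Finsupp.single_apply, apply_ite σ, map_one, map_zero]

/-- The sections of `ρ^* M`, where `ρ(z) = c z`. As `ρ` is an automorphism these are the
`ρ^* s` for `s ∈ M`, with `(ρ^* f) (ρ^* s) = ρ^* (f s)`; thus we keep the underlying group and let
`f(z)` act as `f(c⁻¹ z)`. -/
def RotSec (_ : ℂˣ) (M : Type) : Type := M

section RotSec

variable (c : ℂˣ) (M : Type) [AddCommGroup M] [Module ℂ[X] M]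

instance : AddCommGroup (RotSec c M) := inferInstanceAs (AddCommGroup M)

instance : Module ℂ[X] (RotSec c M) := Module.compHom M (polyRot c⁻¹)

/-- The pullback `s ↦ ρ^* s` of sections. -/
def toRot : M ≃+ RotSec c M := AddEquiv.refl M

theorem toRot_smul (f : ℂ[X]) (s : M) : toRot c M (f • s) = polyRot c f • toRot c M s := by
  change f • s = polyRot c⁻¹ (polyRot c f) • s
  simp [polyRot_polyRot, polyRot_one]

theorem toRot_symm_smul (f : ℂ[X]) (s : RotSec c M) :
    (toRot c M).symm (f • s) = polyRot c⁻¹ f • (toRot c M).symm s := rfl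

theorem polyRotEquiv_apply (f : ℂ[X]) : polyRotEquiv c f = polyRot c f := rfl

/-- A basis of `M` gives a basis of `ρ^* M`. -/
def rotBasis {ι : Type*} (b : Module.Basis ι ℂ[X] M) : Module.Basis ι ℂ[X] (RotSec c M) :=
  semiBasis (polyRotEquiv c) (toRot c M) (toRot_smul c M) b

/-- The pullback of germs of sections at `∞` (additive part). -/
def rotStalkHom : Mer ⊗[ℂ[X]] M →+ Mer ⊗[ℂ[X]] RotSec c M :=
  TensorProduct.liftAddHom
    { toFun := fun f =>
        { toFun := fun s => Mer.rot c⁻¹ f ⊗ₜ[ℂ[X]] toRot c M s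
          map_zero' := by simp
          map_add' := fun s t => by simp [TensorProduct.tmul_add] }
      map_zero' := by ext; simp
      map_add' := fun f g => by ext; simp [TensorProduct.add_tmul] }
    (fun p f s => by
      simp only [AddMonoidHom.coe_mk, ZeroHom.coe_mk, toRot_smul, Algebra.smul_def, map_mul,
        rot_algebraMap]
      rw [← Algebra.smul_def, TensorProduct.smul_tmul])

/-- The inverse of `rotStalkHom`. -/
def rotStalkInv : Mer ⊗[ℂ[X]] RotSec c M →+ Mer ⊗[ℂ[X]] M :=
  TensorProduct.liftAddHom
    { toFun := fun f =>
        { toFun := fun s => Mer.rot c f ⊗ₜ[ℂ[X]] (toRot c M).symm s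
          map_zero' := by simp
          map_add' := fun s t => by simp [TensorProduct.tmul_add] }
      map_zero' := by ext; simp
      map_add' := fun f g => by ext; simp [TensorProduct.add_tmul] }
    (fun p f s => by
      have h := rot_algebraMap c⁻¹ p
      rw [inv_inv] at h
      simp only [AddMonoidHom.coe_mk, ZeroHom.coe_mk, toRot_symm_smul, Algebra.smul_def, map_mul, h]
      rw [← Algebra.smul_def, TensorProduct.smul_tmul])

/-- The pullback of germs of sections at `∞`, `ρ^*(f ⊗ s) = ρ^* f ⊗ ρ^* s`. -/
def rotStalk : Mer ⊗[ℂ[X]] M ≃+ Mer ⊗[ℂ[X]] RotSec c M where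
  toFun := rotStalkHom c M
  invFun := rotStalkInv c M
  left_inv v := by
    induction v using TensorProduct.induction_on with
    | zero => simp
    | tmul f s => simp [rotStalkHom, rotStalkInv, Mer.rot_rot, Mer.rot_one]
    | add v w hv hw => rw [map_add, map_add, hv, hw]
  right_inv v := by
    induction v using TensorProduct.induction_on with
    | zero => simp
    | tmul f s => simp [rotStalkHom, rotStalkInv, Mer.rot_rot, Mer.rot_one]
    | add v w hv hw => rw [map_add, map_add, hv, hw]
  map_add' := map_add _

theorem rotStalk_tmul (f : Mer) (s : M) :
    rotStalk c M (f ⊗ₜ s) = Mer.rot c⁻¹ f ⊗ₜ[ℂ[X]] toRot c M s := rfl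

theorem rotStalk_smul (f : Mer) (v : Mer ⊗[ℂ[X]] M) :
    rotStalk c M (f • v) = Mer.rot c⁻¹ f • rotStalk c M v := by
  induction v using TensorProduct.induction_on with
  | zero => simp
  | tmul g s => simp [TensorProduct.smul_tmul', rotStalk_tmul]
  | add v w hv hw => rw [smul_add, map_add, hv, hw, map_add, smul_add]

theorem rotStalk_symm_smul (f : Mer) (v : Mer ⊗[ℂ[X]] RotSec c M) :
    (rotStalk c M).symm (f • v) = Mer.rot c f • (rotStalk c M).symm v := by
  rw [AddEquiv.symm_apply_eq, rotStalk_smul, AddEquiv.apply_symm_apply, Mer.rot_rot]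
  simp [Mer.rot_one]

instance [Module.Finite ℂ[X] M] [Module.Projective ℂ[X] M] :
    Module.Finite ℂ[X] (RotSec c M) :=
  Module.Finite.of_basis (rotBasis c M (Module.finBasis ℂ[X] M))

instance [Module.Finite ℂ[X] M] [Module.Projective ℂ[X] M] :
    Module.Projective ℂ[X] (RotSec c M) :=
  Module.Projective.of_basis (rotBasis c M (Module.finBasis ℂ[X] M))

end RotSec

/-- `rot` as an automorphism. -/
def rotEquiv (a : ℂˣ) : Mer ≃+* Mer :=
  RingEquiv.ofRingHom (Mer.rot a) (Mer.rot a⁻¹)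
    (RingHom.ext fun f => by simp [Mer.rot_rot, Mer.rot_one])
    (RingHom.ext fun f => by simp [Mer.rot_rot, Mer.rot_one])

/-- The pullback `ρ^* P` of a module of germs of sections at `∞`. -/
def rotSubmodule (c : ℂˣ) (M : Type) [AddCommGroup M] [Module ℂ[X] M]
    (P : Submodule Hol (Mer ⊗[ℂ[X]] M)) : Submodule Hol (Mer ⊗[ℂ[X]] RotSec c M) where
  carrier := {v | (rotStalk c M).symm v ∈ P}
  add_mem' := by
    intro v w hv hw
    simp only [Set.mem_ofPred_eq, map_add] at *
    exact P.add_mem hv hw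
  zero_mem' := by simp
  smul_mem' := by
    rintro ⟨f, hf⟩ v hv
    simp only [Set.mem_ofPred_eq] at *
    have h := P.smul_mem ⟨Mer.rot c f, Mer.rot_mem_hol c hf⟩ hv
    rw [hol_smul] at h ⊢
    rwa [rotStalk_symm_smul]

theorem mem_rotSubmodule (c : ℂˣ) (M : Type) [AddCommGroup M] [Module ℂ[X] M]
    (P : Submodule Hol (Mer ⊗[ℂ[X]] M)) (v : Mer ⊗[ℂ[X]] RotSec c M) :
    v ∈ rotSubmodule c M P ↔ (rotStalk c M).symm v ∈ P := Iff.rfl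

theorem rotSubmodule_span_range (c : ℂˣ) (M : Type) [AddCommGroup M] [Module ℂ[X] M] {ι : Type*}
    (b : ι → Mer ⊗[ℂ[X]] M) :
    rotSubmodule c M (Submodule.span Hol (Set.range b)) =
      Submodule.span Hol (Set.range fun i => rotStalk c M (b i)) := by
  refine le_antisymm (fun v hv => ?_) (Submodule.span_le.2 ?_)
  · rw [mem_rotSubmodule] at hv
    obtain ⟨w, rfl⟩ := (rotStalk c M).surjective v
    rw [AddEquiv.symm_apply_apply] at hv
    induction hv using Submodule.span_induction with
    | mem x hx =>
      obtain ⟨i, rfl⟩ := hx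
      exact Submodule.subset_span (Set.mem_range_self i)
    | zero => simp
    | add x y _ _ hx hy => rw [map_add]; exact Submodule.add_mem _ hx hy
    | smul f x _ hx =>
      rw [hol_smul, rotStalk_smul]
      have h := Submodule.smul_mem _ (⟨Mer.rot c⁻¹ f, Mer.rot_mem_hol c⁻¹ f.2⟩ : Hol) hx
      rwa [hol_smul] at h
  · rintro _ ⟨i, rfl⟩
    have h : (rotStalk c M).symm (rotStalk c M (b i)) = b i := AddEquiv.symm_apply_apply _ _
    rw [SetLike.mem_coe, mem_rotSubmodule, h]
    exact Submodule.subset_span (Set.mem_range_self i)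

/-- The pullback `ρ^* ℰ` of a filtered bundle along `ρ(z) = c z`. -/
def FilteredBundle.rot {K : ℕ} (c : ℂˣ) (E : FilteredBundle K) : FilteredBundle K where
  Sec := RotSec c E.Sec
  rank_eq := by
    rw [Module.finrank_eq_card_basis (rotBasis c E.Sec (Module.finBasis ℂ[X] E.Sec)),
      Fintype.card_fin, E.rank_eq]
  filt α := rotSubmodule c E.Sec (E.filt α)
  lattice α := by
    obtain ⟨b, hb⟩ := E.lattice α
    refine ⟨semiBasis (rotEquiv c⁻¹) (rotStalk c E.Sec) (rotStalk_smul c E.Sec) b, ?_⟩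
    rw [hb, rotSubmodule_span_range]
    congr 2
    funext i
    exact (semiBasis_apply _ _ _ b i).symm
  mono _ _ h _ hv := E.mono h hv
  right_cont α := by
    ext v
    rw [mem_rotSubmodule, E.right_cont α]
    simp only [Submodule.mem_iInf, mem_rotSubmodule]
  shift α v := by
    rw [mem_rotSubmodule, E.shift]
    constructor
    · rintro ⟨w, hw, h⟩
      refine ⟨Mer.const (c⁻¹ : ℂˣ) • rotStalk c E.Sec w, ?_, ?_⟩
      · rw [mem_rotSubmodule, rotStalk_symm_smul, AddEquiv.symm_apply_apply, Mer.rot_const]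
        exact (E.filt α).smul_mem ⟨_, Mer.const_mem_hol _⟩ hw
      · rw [AddEquiv.symm_apply_eq] at h
        rw [h, rotStalk_smul, Mer.rot_coord, smul_smul, mul_comm]
    · rintro ⟨w, hw, rfl⟩
      refine ⟨Mer.const c • (rotStalk c E.Sec).symm w, ?_, ?_⟩
      · exact (E.filt α).smul_mem ⟨_, Mer.const_mem_hol _⟩ hw
      · rw [rotStalk_symm_smul, Mer.rot_coord, smul_smul, mul_comm]

/-- The pullback `ρ^* g` of a map of sections. -/
def rotMap (c : ℂˣ) {M M' : Type} [AddCommGroup M] [Module ℂ[X] M] [AddCommGroup M']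
    [Module ℂ[X] M'] (g : M →ₗ[ℂ[X]] M') : RotSec c M →ₗ[ℂ[X]] RotSec c M' where
  toFun s := toRot c M' (g ((toRot c M).symm s))
  map_add' s t := by simp
  map_smul' p s := by
    rw [toRot_symm_smul, map_smul, toRot_smul, polyRot_polyRot]
    simp [polyRot_one]

/-- The factor `c` with `ρ_t(z) = c z`, that is `c = exp (-K t / (K + N))`. -/
def rotFactor (K N : ℕ) (t : ℂ) : ℂˣ :=
  Units.mk0 (Complex.exp (-(K * t / (K + N)))) (Complex.exp_ne_zero _)

/-- `(ρ_t^* ℰ, e^t ρ_t^* φ)`, where `ρ_t^* φ = (ρ_t^* phi) d(c z) = c (ρ_t^* phi) dz`. -/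
def FilteredHiggs.act {K : ℕ} (N : ℕ) (t : ℂ) (E : FilteredHiggs K) : FilteredHiggs K where
  toFilteredBundle := E.toFilteredBundle.rot (rotFactor K N t)
  phi := (C (Complex.exp t * rotFactor K N t) : ℂ[X]) • rotMap (rotFactor K N t) E.phi

/-- The isomorphism `ρ^* g`. -/
def rotMapEquiv (c : ℂˣ) {M M' : Type} [AddCommGroup M] [Module ℂ[X] M] [AddCommGroup M']
    [Module ℂ[X] M'] (g : M ≃ₗ[ℂ[X]] M') : RotSec c M ≃ₗ[ℂ[X]] RotSec c M' :=
  LinearEquiv.ofLinearMap (rotMap c g.toLinearMap) (rotMap c g.symm.toLinearMap)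
    (LinearMap.ext fun s => by simp [rotMap]) (LinearMap.ext fun s => by simp [rotMap])

theorem rotStalk_symm_baseChange (c : ℂˣ) {M M' : Type} [AddCommGroup M] [Module ℂ[X] M]
    [AddCommGroup M'] [Module ℂ[X] M'] (g : M →ₗ[ℂ[X]] M') (v : Mer ⊗[ℂ[X]] RotSec c M) :
    (rotStalk c M').symm ((rotMap c g).baseChange Mer v) =
      g.baseChange Mer ((rotStalk c M).symm v) := by
  obtain ⟨w, rfl⟩ := (rotStalk c M).surjective v
  rw [AddEquiv.symm_apply_eq, AddEquiv.symm_apply_apply]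
  induction w using TensorProduct.induction_on with
  | zero => simp
  | tmul f s => simp [rotStalk_tmul, rotMap]
  | add v w hv hw => rw [map_add, map_add, hv, hw, map_add, map_add]

theorem IsFilteredIso.rot {K : ℕ} (c : ℂˣ) {E F : FilteredBundle K}
    {g : E.Sec ≃ₗ[ℂ[X]] F.Sec} (hg : IsFilteredIso g) :
    IsFilteredIso (E := E.rot c) (F := F.rot c)
      (rotMapEquiv c (M := E.Sec) (M' := F.Sec) g) := by
  intro α v
  refine (hg α _).trans ?_
  exact Eq.to_iff (congrArg (· ∈ F.filt α) (rotStalk_symm_baseChange c g.toLinearMap v).symm)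

theorem HiggsIso.act {K : ℕ} (N : ℕ) (t : ℂ) {E F : FilteredHiggs K} (h : HiggsIso E F) :
    HiggsIso (E.act N t) (F.act N t) := by
  obtain ⟨g, hg, h⟩ := h
  refine ⟨rotMapEquiv (rotFactor K N t) (M := E.Sec) (M' := F.Sec) g, hg.rot _, fun s => ?_⟩
  have key : ∀ s : RotSec (rotFactor K N t) E.Sec,
      rotMap (rotFactor K N t) g.toLinearMap (rotMap (rotFactor K N t) E.phi s) =
        rotMap (rotFactor K N t) F.phi (rotMap (rotFactor K N t) g.toLinearMap s) := by
    intro s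
    change toRot _ _ (g (E.phi ((toRot _ _).symm s))) = toRot _ _ (F.phi (g ((toRot _ _).symm s)))
    rw [h]
  refine (map_smul (rotMap (rotFactor K N t) g.toLinearMap) _ _).trans ?_
  exact congrArg _ (key s)

/-- The action of `t` on isomorphism classes, `[(ℰ, φ)] ↦ [(ρ_t^* ℰ, e^t ρ_t^* φ)]`. -/
def classAct {K : ℕ} (N : ℕ) (t : ℂ) : HiggsClass K → HiggsClass K :=
  Quotient.map (FilteredHiggs.act N t) fun _ _ h => HiggsIso.act N t h

/-- The `ℂ^×`-fixed points in `ℳ_{K,N}`; `t` runs through `ℂ`, on which the action factors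
through `ℂ / 2πi(K + N)ℤ ≃ ℂ^×`. -/
def fixedPoints (K N : ℕ) [NeZero K] : Set (HiggsClass K) :=
  {q | q ∈ moduli K N ∧ ∀ t : ℂ, classAct N t q = q}

/-! ### Cyclic partitions and the bundles attached to them -/

/-- Ordered `K`-partitions of `N`. -/
abbrev OrderedPartition (K N : ℕ) : Type := {b : Fin K → ℕ // ∑ i, b i = N}

/-- Two ordered partitions are equivalent if they differ by a cyclic permutation of the indices. -/
instance cyclicSetoid (K N : ℕ) : Setoid (OrderedPartition K N) where
  r b b' := ∃ k : ℕ, ∀ i, b'.1 i = b.1 ((finRotate K ^ k) i)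
  iseqv :=
    { refl := fun b => ⟨0, fun i => rfl⟩
      symm := by
        rintro b b' ⟨k, h⟩
        refine ⟨orderOf (finRotate K) * k - k, fun i => ?_⟩
        have ho : 0 < orderOf (finRotate K) := orderOf_pos _
        rw [h, ← Equiv.Perm.mul_apply, ← pow_add,
          Nat.add_sub_cancel' (Nat.le_mul_of_pos_left k ho), pow_mul, pow_orderOf_eq_one, one_pow]
        rfl
      trans := by
        rintro b b' b'' ⟨k, h⟩ ⟨l, h'⟩
        refine ⟨k + l, fun i => ?_⟩
        rw [h', h, ← Equiv.Perm.mul_apply, ← pow_add] }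

/-- Cyclic `K`-partitions of `N`. -/
abbrev CyclicPartition (K N : ℕ) : Type := Quotient (cyclicSetoid K N)

/-- The parabolic degrees `α_i` attached to `b`. -/
def parDeg {K N : ℕ} (b : OrderedPartition K N) (i : Fin K) : ℝ :=
  ∑ j, ((K - 1 : ℝ) - 2 * ((j - i : Fin K) : ℕ)) / (2 * K) * b.1 j

theorem parDeg_sub {K N : ℕ} (b : OrderedPartition K N) (i : Fin K) :
    parDeg b i - parDeg b (finRotate K i) = b.1 i - (N : ℝ) / K := by
  obtain ⟨n, rfl⟩ : ∃ n, K = n + 1 := ⟨K - 1, by have := i.2; omega⟩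
  have key : ∀ j : Fin (n + 1), (((j - (i + 1) : Fin (n + 1)) : ℕ) : ℝ) =
      ((j - i : Fin (n + 1)) : ℕ) - 1 + if j = i then (n + 1 : ℝ) else 0 := by
    intro j
    obtain ⟨d, rfl⟩ : ∃ d, j = i + d := ⟨j - i, by simp⟩
    have h1 : i + d - (i + 1) = d - 1 := by abel
    rw [h1, add_sub_cancel_left, Fin.coe_sub_one]
    by_cases hd : d = 0
    · simp [hd]
    · have h2 : i + d ≠ i := by simpa using hd
      have h3 : 1 ≤ (d : ℕ) := Nat.one_le_iff_ne_zero.2 fun h => hd (Fin.ext h)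
      simp [hd, Nat.cast_sub h3]
  have hN : (N : ℝ) = ∑ j, (b.1 j : ℝ) := by exact_mod_cast b.2.symm
  have hK : ((n : ℝ) + 1) ≠ 0 := by positivity
  have hs : (b.1 i : ℝ) = ∑ j, (if j = i then (b.1 j : ℝ) else 0) := by simp
  rw [finRotate_apply, parDeg, parDeg, ← Finset.sum_sub_distrib, hN, hs, Finset.sum_div,
    ← Finset.sum_sub_distrib]
  refine Finset.sum_congr rfl fun j _ => ?_
  rw [key]
  push_cast
  split_ifs <;> field_simp <;> ring

theorem sum_parDeg {K N : ℕ} (b : OrderedPartition K N) : ∑ i, parDeg b i = 0 := by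
  rcases K with _ | n
  · simp
  have hK : ((n : ℝ) + 1) ≠ 0 := by positivity
  simp only [parDeg]
  rw [Finset.sum_comm]
  refine Finset.sum_eq_zero fun j _ => ?_
  rw [← Finset.sum_mul, ← Finset.sum_div, Finset.sum_sub_distrib, ← Finset.mul_sum]
  have h : ∑ i : Fin (n + 1), (((j - i : Fin (n + 1)) : ℕ) : ℝ) = n * (n + 1) / 2 := by
    rw [show ∑ i : Fin (n + 1), (((j - i : Fin (n + 1)) : ℕ) : ℝ) = ∑ i : Fin (n + 1), ((i : ℕ) : ℝ)
        from (Equiv.subLeft j).sum_comp fun k : Fin (n + 1) => ((k : ℕ) : ℝ),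
      Fin.sum_univ_eq_sum_range (fun k => (k : ℝ))]
    have h2 := Finset.sum_range_id_mul_two (n + 1)
    have h3 : ((∑ i ∈ Finset.range (n + 1), i : ℕ) : ℝ) * 2 = (n + 1) * n := by
      exact_mod_cast h2
    push_cast at h3
    linarith
  rw [h]
  simp
  left
  left
  ring

theorem coord_zpow_mem {n : ℤ} (hn : 0 ≤ n) : Mer.coord ^ n ∈ Hol := by
  lift n to ℕ using hn
  rw [zpow_natCast]
  exact pow_mem Mer.coord_mem_hol n

theorem PoleLE.mono {a : Mer} {β γ : ℝ} (h : β ≤ γ) (ha : Mer.PoleLE a β) : Mer.PoleLE a γ := by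
  have h' := Hol.mul_mem (coord_zpow_mem (sub_nonneg.2 (Int.floor_mono h))) ha
  rwa [← mul_assoc, ← zpow_add₀ Mer.coord_ne_zero, sub_add_cancel] at h'

/-- The filtered bundle `⨁ 𝒪(α_i)`: the basis section `e_i` of `𝒪(α_i)` has order `-α_i` at `∞`,
so `∑ h_i e_i` is in the `β`-th step if and only if each `h_i` has a pole of order at most
`α_i + β`. -/
def sumO {K : ℕ} (α : Fin K → ℝ) : FilteredBundle K where
  Sec := Fin K → ℂ[X]
  rank_eq := by simp
  filt β :=
    { carrier := {v | ∀ i, Mer.PoleLE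
        ((Algebra.TensorProduct.basis Mer (Pi.basisFun ℂ[X] (Fin K))).repr v i) (α i + β)}
      add_mem' := by
        intro v w hv hw i
        simp only [Mer.PoleLE, map_add, Finsupp.add_apply, mul_add]
        exact Hol.add_mem (hv i) (hw i)
      zero_mem' := by
        intro i
        simp [Mer.PoleLE, Hol.zero_mem]
      smul_mem' := by
        intro f v hv i
        rw [hol_smul, map_smul, Finsupp.smul_apply, smul_eq_mul, Mer.PoleLE, mul_left_comm]
        exact Hol.mul_mem f.2 (hv i) }
  lattice β := by
    set e := Algebra.TensorProduct.basis Mer (Pi.basisFun ℂ[X] (Fin K)) with he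
    have hu : ∀ i, IsUnit (Mer.coord ^ (-⌊α i + β⌋)) := fun i =>
      (zpow_ne_zero _ Mer.coord_ne_zero).isUnit
    refine ⟨e.isUnitSMul hu, le_antisymm (fun v hv => ?_) (Submodule.span_le.2 ?_)⟩
    · rw [← e.sum_repr v]
      refine Submodule.sum_mem _ fun i _ => ?_
      have h := Submodule.smul_mem (Submodule.span Hol (Set.range (e.isUnitSMul hu)))
        (⟨_, hv i⟩ : Hol) (Submodule.subset_span ⟨i, rfl⟩)
      rw [hol_smul, Module.Basis.isUnitSMul_apply, smul_smul, mul_right_comm,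
        ← zpow_add₀ Mer.coord_ne_zero, add_neg_cancel, zpow_zero, one_mul] at h
      exact h
    · rintro _ ⟨j, rfl⟩ i
      rw [Module.Basis.isUnitSMul_apply, map_smul, Finsupp.smul_apply,
        Module.Basis.repr_self, Finsupp.single_apply, Mer.PoleLE]
      split_ifs with h
      · subst h
        rw [smul_eq_mul, mul_one, ← zpow_add₀ Mer.coord_ne_zero, add_neg_cancel, zpow_zero]
        exact Hol.one_mem
      · simp [Hol.zero_mem]
  mono β γ h v hv i := PoleLE.mono (by linarith) (hv i)
  right_cont β := by
    ext v
    simp only [Submodule.mem_iInf]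
    refine ⟨fun hv γ hγ i => PoleLE.mono (by linarith [hγ.lt]) (hv i), fun hv i => ?_⟩
    have hlt := Int.lt_floor_add_one (α i + β)
    set γ := (β + (⌊α i + β⌋ + 1 - α i)) / 2 with hγ
    have h1 : γ > β := by rw [hγ]; linarith
    have h2 : ⌊α i + γ⌋ = ⌊α i + β⌋ := by
      rw [Int.floor_eq_iff]
      have := Int.floor_le (α i + β)
      constructor <;> linarith
    have h3 : Mer.PoleLE _ _ := hv γ h1 i
    rwa [Mer.PoleLE, h2] at h3
  shift β v := by
    constructor
    · intro hv
      refine ⟨Mer.coord⁻¹ • v, fun i => ?_, ?_⟩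
      · have h : Mer.PoleLE _ _ := hv i
        rw [Mer.PoleLE, ← add_sub_assoc, Int.floor_sub_one, zpow_sub₀ Mer.coord_ne_zero, zpow_one,
          div_eq_mul_inv, mul_assoc] at h
        rw [map_smul, Finsupp.smul_apply, smul_eq_mul]
        exact h
      · rw [smul_smul, mul_inv_cancel₀ Mer.coord_ne_zero, one_smul]
    · rintro ⟨w, hw, rfl⟩ i
      have h : Mer.PoleLE _ _ := hw i
      rw [map_smul, Finsupp.smul_apply, smul_eq_mul, Mer.PoleLE, ← add_sub_assoc, Int.floor_sub_one,
        zpow_sub₀ Mer.coord_ne_zero, zpow_one, div_eq_mul_inv, mul_assoc,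
        inv_mul_cancel_left₀ Mer.coord_ne_zero]
      exact h

/-- The matrix of `φ_b / dz`, with `z ^ b_i` in row `i` and column `i + 1` (cyclically). -/
def cyclicMatrix {K N : ℕ} (b : OrderedPartition K N) : Matrix (Fin K) (Fin K) ℂ[X] :=
  Matrix.of fun i j => if j = finRotate K i then X ^ b.1 i else 0

/-- The filtered Higgs bundle `(ℰ_b, φ_b)`. -/
def higgsOf {K N : ℕ} (b : OrderedPartition K N) : FilteredHiggs K where
  toFilteredBundle := sumO (parDeg b)
  phi := Matrix.toLin' (cyclicMatrix b)

/-- The stratum of `ℳ_{K,N}` labelled by a cyclic partition `[b]`: the classes of those `(ℰ, φ)`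
with `ℰ ≃ ⨁ 𝒪(α_i)` as filtered bundles, where `α_i - α_{i+1} = b_i - N / K`. -/
def stratum {K N : ℕ} [NeZero K] (p : CyclicPartition K N) : Set (HiggsClass K) :=
  {q | q ∈ moduli K N ∧ ∃ (b : OrderedPartition K N) (E : FilteredHiggs K),
    (⟦b⟧ : CyclicPartition K N) = p ∧ (⟦E⟧ : HiggsClass K) = q ∧
      ∃ g : E.Sec ≃ₗ[ℂ[X]] (sumO (parDeg b)).Sec,
        IsFilteredIso (E := E.toFilteredBundle) (F := sumO (parDeg b)) g}

end

end WildHiggs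

namespace WildHiggs

open Mer

/-! ### Valuations of meromorphic germs -/

/-! Surjectivity. For `t = 2πi(K+N)/K` the map `ρ_t` is the identity, while `κ = e^t` is a primitive
`K`-th root of unity because `K` and `N` are coprime. A fixed point therefore has a filtered
automorphism `g` with `φ g = κ g φ` (`exists_automorphism_of_act`). The coefficients of the
characteristic polynomial of `g` are polynomials in `z` without a pole at `∞`, hence constants, so
`g` has a constant eigenvalue `μ`. The condition at `∞` makes `φ` injective, and `φ` multiplies
`g`-eigenvalues by `κ⁻¹`; so `g` has the `K` distinct eigenvalues `μ κ^j`. Its spectral projections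
are polynomials in `g` with constant coefficients. They split both the module of sections and the
filtration, and `ℰ` becomes a sum of lines `𝒪(a_i)` which `φ` permutes cyclically, with polynomial
entries `p_i`.

It remains to pin down `p_i` and `a_i`. Going round the cycle, `φ^K` is multiplication by `∏ p_i`.
By the condition at `∞` this is monic of degree `N`; fixedness under `t = 1`, a contraction of the
plane, makes it semi-invariant, so it is `z^N`. Hence `p_i = c_i z^{b_i}` with `∑ b_i = N` and `∏
c_i = 1`, and rescaling the lines removes the `c_i`. The Higgs field raises orders at `∞` by exactly
`N/K`, which gives `a_i - a_{i+1} = b_i - N/K`, and the `SL(K)`-structure gives `∑ a_i = 0`;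
together these determine `a` (`exists_higgsIso_higgsOf`).

Conversely, on the cover `u^{2K} = 1/z` the field `φ_b` becomes, in a basis splitting the
filtration, `u^{-2N}` times a cyclic shift, which a constant Vandermonde matrix diagonalises
(`isGoodAtInfinity_higgsOf`). The action only multiplies the entries of `φ_b` by constants of
product `1`, so `(ℰ_b, φ_b)` is fixed.

Injectivity. A filtered isomorphism preserves the degrees `α_i` up to permutation. Modulo `ℤ` one
has `α_{i+k} ≡ α_i + kN/K`, so coprimality makes the classes of the `α_i` distinct and forces the
permutation to be cyclic (`cyclic_of_isFilteredIso`). The Higgs field plays no role here, so the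
underlying filtered bundle already determines `[b]`, and each stratum has only one fixed point. -/

theorem Mer.exists_eq_zpow_mul {a : Mer} (ha : a ≠ 0) :
    ∃ (n : ℤ) (w : Mer), w ∈ Hol ∧ w⁻¹ ∈ Hol ∧ w ≠ 0 ∧ a = coord ^ n * w := by
  obtain ⟨f, hf, rfl⟩ := exists_rep a
  have htop : meromorphicOrderAt f 0 ≠ ⊤ := fun h =>
    ha ((mk_eq_mk hf (MeromorphicAt.const 0 0)).2 (meromorphicOrderAt_eq_top_iff.1 h))
  obtain ⟨g, hg, hg0, h⟩ := (meromorphicOrderAt_ne_top_iff hf).1 htop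
  set n := (meromorphicOrderAt f 0).untop₀
  have hfg : mk f hf = coord ^ n * mk g hg.meromorphicAt := by
    have h1 : coord ^ n = mk (fun x => x ^ n) ((MeromorphicAt.id 0).zpow n) := by
      apply Subtype.ext
      cases n with
      | ofNat k => simp only [Int.ofNat_eq_natCast, zpow_natCast]; rfl
      | negSucc k => simp only [zpow_negSucc]; rfl
    rw [h1]
    refine (mk_eq_mk hf (((MeromorphicAt.id 0).zpow n).mul hg.meromorphicAt)).2 ?_
    filter_upwards [h] with x hx
    simpa using hx
  refine ⟨n, mk g hg.meromorphicAt, ⟨g, hg, rfl⟩, ⟨g⁻¹, hg.inv hg0, rfl⟩, ?_, hfg⟩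
  rintro h0
  rw [h0, mul_zero] at hfg
  exact ha hfg

theorem Mer.inv_mem_hol_of_one_add {h : Mer} (hh : h ∈ Hol) : (1 + coord * h)⁻¹ ∈ Hol := by
  obtain ⟨f, hf, rfl⟩ := hh
  have h1 : AnalyticAt ℂ (fun x => 1 + x * f x) 0 := by fun_prop
  exact ⟨_, h1.inv (by simp), rfl⟩

/-- If `1/x` agreed with an analytic `f`, the function `x f(x)` would be `1` near `0` but tend to
`0`. All lower bounds on pole orders below come from this fact. -/
theorem Mer.coord_inv_not_mem : coord⁻¹ ∉ Hol := by
  rintro ⟨f, hf, h⟩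
  have h1 := (mk_eq_mk hf.meromorphicAt (MeromorphicAt.id 0).inv).1 h
  have h2 : ∀ᶠ x : ℂ in 𝓝[≠] 0, x * f x = 1 := by
    filter_upwards [h1, eventually_mem_nhdsWithin] with x hx hx0
    rw [hx]
    exact mul_inv_cancel₀ hx0
  have h3 : Tendsto (fun x => x * f x) (𝓝[≠] 0) (𝓝 (0 * f 0)) :=
    ((continuousAt_id.mul hf.continuousAt).tendsto).mono_left nhdsWithin_le_nhds
  have h4 := tendsto_nhds_unique h3 ((tendsto_congr' h2).2 tendsto_const_nhds)
  simp at h4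

theorem coord_zpow_mem_iff {n : ℤ} : Mer.coord ^ n ∈ Hol ↔ 0 ≤ n := by
  refine ⟨fun h => ?_, coord_zpow_mem⟩
  by_contra! hn
  refine Mer.coord_inv_not_mem ?_
  have h' := Hol.mul_mem h (coord_zpow_mem (n := -n - 1) (by lia))
  rwa [← zpow_add₀ Mer.coord_ne_zero, show n + (-n - 1) = -1 by ring, zpow_neg_one] at h'

theorem PoleLE.zero (β : ℝ) : Mer.PoleLE 0 β := by simp [Mer.PoleLE, Hol.zero_mem]

theorem PoleLE.add {a b : Mer} {β : ℝ} (ha : Mer.PoleLE a β) (hb : Mer.PoleLE b β) :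
    Mer.PoleLE (a + b) β := by
  rw [Mer.PoleLE, mul_add]
  exact Hol.add_mem ha hb

theorem PoleLE.sum {ι : Type*} {s : Finset ι} {a : ι → Mer} {β : ℝ}
    (ha : ∀ i ∈ s, Mer.PoleLE (a i) β) : Mer.PoleLE (∑ i ∈ s, a i) β := by
  rw [Mer.PoleLE, Finset.mul_sum]
  exact Hol.sum_mem ha

theorem PoleLE.hol_mul {h a : Mer} {β : ℝ} (hh : h ∈ Hol) (ha : Mer.PoleLE a β) :
    Mer.PoleLE (h * a) β := by
  rw [Mer.PoleLE, mul_left_comm]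
  exact Hol.mul_mem hh ha

theorem PoleLE.mul {a b : Mer} {β γ : ℝ} (ha : Mer.PoleLE a β) (hb : Mer.PoleLE b γ) :
    Mer.PoleLE (a * b) (β + γ) := by
  have h : ⌊β⌋ + ⌊γ⌋ ≤ ⌊β + γ⌋ := Int.le_floor_add β γ
  have h1 := Hol.mul_mem (coord_zpow_mem (sub_nonneg.2 h)) (Hol.mul_mem ha hb)
  rw [Mer.PoleLE]
  rwa [mul_mul_mul_comm, ← zpow_add₀ Mer.coord_ne_zero, ← mul_assoc,
    ← zpow_add₀ Mer.coord_ne_zero, sub_add_cancel] at h1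

theorem poleLE_unit_mul {w a : Mer} {β : ℝ} (hw : w ∈ Hol) (hw' : w⁻¹ ∈ Hol) (h0 : w ≠ 0) :
    Mer.PoleLE (w * a) β ↔ Mer.PoleLE a β := by
  refine ⟨fun h => ?_, PoleLE.hol_mul hw⟩
  have := PoleLE.hol_mul hw' h
  rwa [inv_mul_cancel_left₀ h0] at this

theorem poleLE_const_mul {c : ℂ} (hc : c ≠ 0) {a : Mer} {β : ℝ} :
    Mer.PoleLE (Mer.const c * a) β ↔ Mer.PoleLE a β :=
  poleLE_unit_mul (Mer.const_mem_hol c) (by rw [← map_inv₀]; exact Mer.const_mem_hol _)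
    ((_root_.map_ne_zero _).2 hc)

theorem poleLE_zpow_mul {n : ℤ} {a : Mer} {β : ℝ} :
    Mer.PoleLE (Mer.coord ^ n * a) β ↔ Mer.PoleLE a (β + n) := by
  rw [Mer.PoleLE, Mer.PoleLE, ← mul_assoc, ← zpow_add₀ Mer.coord_ne_zero, Int.floor_add_intCast]

theorem poleLE_one {β : ℝ} : Mer.PoleLE 1 β ↔ 0 ≤ β := by
  rw [Mer.PoleLE, mul_one, coord_zpow_mem_iff, Int.floor_nonneg]

theorem poleLE_zpow {n : ℤ} {β : ℝ} : Mer.PoleLE (Mer.coord ^ n) β ↔ 0 ≤ β + n := by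
  rw [← mul_one (Mer.coord ^ n), poleLE_zpow_mul, poleLE_one]

theorem poleLE_unit {w : Mer} {β : ℝ} (hw : w ∈ Hol) (hw' : w⁻¹ ∈ Hol) (h0 : w ≠ 0) :
    Mer.PoleLE w β ↔ 0 ≤ β := by
  rw [← mul_one w, poleLE_unit_mul hw hw' h0, poleLE_one]

theorem PoleLE.exists_bound (a : Mer) : ∃ n : ℤ, Mer.PoleLE a n := by
  by_cases ha : a = 0
  · exact ⟨0, ha ▸ PoleLE.zero _⟩
  obtain ⟨n, w, hw, hw', hw0, rfl⟩ := Mer.exists_eq_zpow_mul ha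
  refine ⟨-n, ?_⟩
  rw [poleLE_zpow_mul, poleLE_unit hw hw' hw0]
  simp

/-- The one-units `1 + x h`, with `h` holomorphic. -/
def oneUnits : Submonoid Mer where
  carrier := {w | ∃ h ∈ Hol, w = 1 + Mer.coord * h}
  one_mem' := ⟨0, Hol.zero_mem, by simp⟩
  mul_mem' := by
    rintro _ _ ⟨h, hh, rfl⟩ ⟨k, hk, rfl⟩
    refine ⟨h + k + Mer.coord * h * k, ?_, by ring⟩
    exact Hol.add_mem (Hol.add_mem hh hk) (Hol.mul_mem (Hol.mul_mem Mer.coord_mem_hol hh) hk)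

theorem mem_oneUnits {w : Mer} : w ∈ oneUnits ↔ ∃ h ∈ Hol, w = 1 + Mer.coord * h := Iff.rfl

theorem one_add_coord_mul_ne_zero {h : Mer} (hh : h ∈ Hol) : 1 + Mer.coord * h ≠ 0 := by
  intro h0
  apply Mer.coord_inv_not_mem
  have h1 : Mer.coord⁻¹ = -h := by
    refine inv_eq_of_mul_eq_one_right ?_
    linear_combination -h0
  rw [h1]
  exact Hol.neg_mem hh

theorem oneUnits_spec {w : Mer} (hw : w ∈ oneUnits) : w ∈ Hol ∧ w⁻¹ ∈ Hol ∧ w ≠ 0 := by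
  obtain ⟨h, hh, rfl⟩ := mem_oneUnits.1 hw
  exact ⟨Hol.add_mem Hol.one_mem (Hol.mul_mem Mer.coord_mem_hol hh), Mer.inv_mem_hol_of_one_add hh,
    one_add_coord_mul_ne_zero hh⟩

/-- Membership in the steps of the pole-order filtration detects the exponent; reduction modulo `x`
then detects the coefficient. -/
theorem leading_term_unique {a b : ℂ} (ha : a ≠ 0) (hb : b ≠ 0) {m n : ℤ} {v w : Mer}
    (hv : v ∈ oneUnits) (hw : w ∈ oneUnits)
    (h : Mer.const a * (Mer.coord ^ m * v) = Mer.const b * (Mer.coord ^ n * w)) :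
    m = n ∧ a = b := by
  obtain ⟨hv1, hv2, hv3⟩ := oneUnits_spec hv
  obtain ⟨hw1, hw2, hw3⟩ := oneUnits_spec hw
  have key : ∀ β : ℝ, 0 ≤ β + m ↔ 0 ≤ β + n := fun β => by
    rw [← poleLE_unit hv1 hv2 hv3, ← poleLE_zpow_mul, ← poleLE_const_mul ha, h,
      poleLE_const_mul hb, poleLE_zpow_mul, poleLE_unit hw1 hw2 hw3]
  have hmn : m = n := by
    have h1 := (key (-m)).1 (by simp)
    have h2 := (key (-n)).2 (by simp)
    have h3 : (m : ℝ) = n := by linarith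
    exact_mod_cast h3
  refine ⟨hmn, ?_⟩
  subst hmn
  rw [mul_left_comm, mul_left_comm (Mer.const b)] at h
  have h' := mul_left_cancel₀ (zpow_ne_zero m Mer.coord_ne_zero) h
  obtain ⟨f, hf, rfl⟩ := mem_oneUnits.1 hv
  obtain ⟨g, hg, rfl⟩ := mem_oneUnits.1 hw
  -- Otherwise the nonzero constant `a - b` would be `x` times a holomorphic germ, and `x⁻¹` would
  -- be holomorphic.
  by_contra hab
  apply Mer.coord_inv_not_mem
  have h1 : Mer.const (a - b) = Mer.coord * (Mer.const b * g - Mer.const a * f) := by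
    rw [map_sub]
    linear_combination h'
  have h2 : Mer.coord⁻¹ = Mer.const (a - b)⁻¹ * (Mer.const b * g - Mer.const a * f) := by
    rw [map_inv₀, eq_inv_mul_iff_mul_eq₀ ((_root_.map_ne_zero _).2 (sub_ne_zero.2 hab)), h1, mul_comm,
      inv_mul_cancel_left₀ Mer.coord_ne_zero]
  rw [h2]
  exact Hol.mul_mem (Mer.const_mem_hol _) (Hol.sub_mem (Hol.mul_mem (Mer.const_mem_hol _) hg)
    (Hol.mul_mem (Mer.const_mem_hol _) hf))

/-! ### Polynomials as germs at infinity -/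

theorem algebraMap_C (c : ℂ) : algebraMap ℂ[X] Mer (C c) = Mer.const c := by
  simp [algebraMap_poly]

theorem algebraMap_X : algebraMap ℂ[X] Mer X = Mer.coord⁻¹ := by
  simp [algebraMap_poly]

theorem algebraMap_X_pow (n : ℕ) : algebraMap ℂ[X] Mer (X ^ n) = Mer.coord ^ (-n : ℤ) := by
  rw [map_pow, algebraMap_X, zpow_neg, zpow_natCast, inv_pow]

/-- The leading term at `∞` of a polynomial. -/
theorem exists_leading_term {p : ℂ[X]} (hp : p ≠ 0) : ∃ w ∈ oneUnits,
    algebraMap ℂ[X] Mer p = Mer.const p.leadingCoeff * (Mer.coord ^ (-p.natDegree : ℤ) * w) := by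
  have hlc : p.leadingCoeff ≠ 0 := leadingCoeff_ne_zero.2 hp
  set d := p.natDegree with hd
  refine ⟨Mer.const p.leadingCoeff⁻¹ * (Mer.coord ^ (d : ℤ) * algebraMap ℂ[X] Mer p), ?_, ?_⟩
  -- With `d = deg p` and `p = ∑ a_i x^{-i}`, dividing by `a_d x^{-d}` leaves `1 + a_d⁻¹ ∑_{i<d} a_i
  -- x^{d-i}`, from which one factor `x` is taken out.
  · refine mem_oneUnits.2 ⟨Mer.const p.leadingCoeff⁻¹ *
      ∑ i ∈ Finset.range d, Mer.const (p.coeff i) * Mer.coord ^ ((d : ℤ) - 1 - i), ?_, ?_⟩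
    · refine Hol.mul_mem (Mer.const_mem_hol _) (Hol.sum_mem fun i hi => ?_)
      have := Finset.mem_range.1 hi
      exact Hol.mul_mem (Mer.const_mem_hol _) (coord_zpow_mem (by lia))
    · rw [algebraMap_poly, eval₂_eq_sum_range, ← hd, Finset.sum_range_succ, mul_add, mul_add,
        add_comm]
      congr 1
      · rw [inv_pow, ← zpow_natCast Mer.coord, mul_left_comm (Mer.coord ^ _),
          mul_inv_cancel₀ (zpow_ne_zero _ Mer.coord_ne_zero), mul_one, hd, coeff_natDegree,
          ← map_mul, inv_mul_cancel₀ hlc, map_one]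
      · rw [mul_left_comm Mer.coord]
        congr 1
        rw [Finset.mul_sum, Finset.mul_sum]
        refine Finset.sum_congr rfl fun i _ => ?_
        rw [mul_left_comm, mul_left_comm Mer.coord]
        congr 1
        rw [inv_pow, ← zpow_natCast Mer.coord i, ← zpow_neg, ← zpow_add₀ Mer.coord_ne_zero,
          ← zpow_one_add₀ Mer.coord_ne_zero]
        congr 1
        ring
  · rw [mul_left_comm (Mer.coord ^ _), ← mul_assoc (Mer.coord ^ _), ← zpow_add₀ Mer.coord_ne_zero,
      neg_add_cancel, zpow_zero, one_mul, ← mul_assoc, ← map_mul, mul_inv_cancel₀ hlc, map_one,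
      one_mul]

theorem natDegree_le_of_poleLE {p : ℂ[X]} (hp : p ≠ 0) {γ : ℝ}
    (h : Mer.PoleLE (algebraMap ℂ[X] Mer p) γ) : (p.natDegree : ℝ) ≤ γ := by
  obtain ⟨w, hw, hpw⟩ := exists_leading_term hp
  obtain ⟨h1, h2, h3⟩ := oneUnits_spec hw
  rw [hpw, poleLE_const_mul (leadingCoeff_ne_zero.2 hp), poleLE_zpow_mul,
    poleLE_unit h1 h2 h3] at h
  push_cast at h
  linarith

/-- The form of Liouville's theorem used for global sections: no pole at `∞` means degree `0`. -/
theorem algebraMap_mem_hol {p : ℂ[X]} (h : algebraMap ℂ[X] Mer p ∈ Hol) :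
    p = C (p.coeff 0) := by
  by_cases hp : p = 0
  · simp [hp]
  have h1 := natDegree_le_of_poleLE (γ := 0) hp (by simpa [Mer.PoleLE] using h)
  exact eq_C_of_natDegree_eq_zero (by exact_mod_cast le_antisymm h1 (Nat.cast_nonneg _))

theorem algebraMap_poly_injective : Function.Injective (algebraMap ℂ[X] Mer) := by
  rw [injective_iff_map_eq_zero]
  intro p h
  by_contra hp
  obtain ⟨w, hw, hpw⟩ := exists_leading_term hp
  rw [h] at hpw
  have h1 := (_root_.map_ne_zero Mer.const).2 (leadingCoeff_ne_zero.2 hp)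
  exact mul_ne_zero h1 (mul_ne_zero (zpow_ne_zero _ Mer.coord_ne_zero) (oneUnits_spec hw).2.2)
    hpw.symm

/-! ### Rotations and the cover: effect on pole orders -/

theorem poleLE_rot (c : ℂˣ) {a : Mer} {β : ℝ} : Mer.PoleLE (Mer.rot c a) β ↔ Mer.PoleLE a β := by
  have key : ∀ (c : ℂˣ) (a : Mer), Mer.PoleLE a β → Mer.PoleLE (Mer.rot c a) β := by
    intro c a h
    have h1 := Mer.rot_mem_hol c h
    rw [map_mul, map_zpow₀, Mer.rot_coord, mul_zpow, mul_assoc, ← map_zpow₀] at h1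
    exact (poleLE_const_mul (zpow_ne_zero _ c.ne_zero)).1
      (by rwa [Mer.PoleLE, mul_left_comm])
  refine ⟨fun h => ?_, key c a⟩
  have h1 := key c⁻¹ _ h
  rwa [Mer.rot_rot, mul_inv_cancel, Mer.rot_one] at h1

theorem powPull_coord (m : ℕ) [NeZero m] : Mer.powPull m Mer.coord = Mer.coord ^ m := rfl

theorem powPull_const (m : ℕ) [NeZero m] (c : ℂ) : Mer.powPull m (Mer.const c) = Mer.const c := rfl

theorem powPull_mem_hol (m : ℕ) [NeZero m] {a : Mer} (ha : a ∈ Hol) : Mer.powPull m a ∈ Hol := by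
  obtain ⟨f, hf, rfl⟩ := ha
  refine ⟨fun x => f (x ^ m), ?_, rfl⟩
  have h : AnalyticAt ℂ (fun x : ℂ => x ^ m) 0 := by fun_prop
  exact AnalyticAt.fun_comp (by simpa [NeZero.ne m] using hf) h

theorem powPull_zpow_coord (m : ℕ) [NeZero m] (n : ℤ) :
    Mer.powPull m (Mer.coord ^ n) = Mer.coord ^ (m * n) := by
  rw [map_zpow₀, powPull_coord, zpow_mul, zpow_natCast]

theorem powPull_oneUnits (m : ℕ) [NeZero m] {w : Mer} (hw : w ∈ oneUnits) :
    Mer.powPull m w ∈ oneUnits := by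
  obtain ⟨h, hh, rfl⟩ := mem_oneUnits.1 hw
  obtain ⟨k, hk⟩ := Nat.exists_eq_succ_of_ne_zero (NeZero.ne m)
  refine ⟨Mer.coord ^ k * Mer.powPull m h,
    Hol.mul_mem (pow_mem Mer.coord_mem_hol k) (powPull_mem_hol m hh), ?_⟩
  rw [map_add, map_one, map_mul, powPull_coord, ← mul_assoc, ← pow_succ', ← Nat.succ_eq_add_one, ← hk]

/-- The bound is `m ⌊β⌋`, possibly smaller than `⌊m β⌋`: a pole order is an integer before it is
multiplied by `m`. -/
theorem PoleLE.powPull (m : ℕ) [NeZero m] {a : Mer} {β : ℝ} (ha : Mer.PoleLE a β) :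
    Mer.PoleLE (Mer.powPull m a) (m * ⌊β⌋ : ℤ) := by
  have h := powPull_mem_hol m ha
  rw [map_mul, powPull_zpow_coord] at h
  rwa [Mer.PoleLE, Int.floor_intCast]

/-- An increasing right-continuous filtration of the field of germs by lattices, compatible with
multiplication by the coordinate, is the filtration by pole order up to a shift. -/
theorem exists_poleLE_shift (P : ℝ → Submodule Hol Mer) (mono : Monotone P)
    (right_cont : ∀ α h, (∀ β > α, h ∈ P β) → h ∈ P α)
    (shift : ∀ α h, h ∈ P (α - 1) ↔ ∃ w ∈ P α, h = Mer.coord * w)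
    (hne : ∃ h ∈ P 0, h ≠ 0) (hbdd : ∃ n : ℤ, ∀ h ∈ P 0, Mer.PoleLE h n) :
    ∃ a : ℝ, ∀ α h, h ∈ P α ↔ Mer.PoleLE h (a + α) := by
  have hsmul : ∀ {α h k}, k ∈ Hol → h ∈ P α → k * h ∈ P α := fun {α h k} hk hh =>
    (P α).smul_mem (⟨k, hk⟩ : Hol) hh
  have shift1 : ∀ α h, Mer.coord * h ∈ P α ↔ h ∈ P (α + 1) := fun α h => by
    have := shift (α + 1) (Mer.coord * h)
    rw [add_sub_cancel_right] at this
    rw [this]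
    refine ⟨?_, fun hh => ⟨h, hh, rfl⟩⟩
    rintro ⟨w, hw, hw'⟩
    rwa [mul_left_cancel₀ Mer.coord_ne_zero hw']
  have shiftn : ∀ (n : ℕ) α h, Mer.coord ^ n * h ∈ P α ↔ h ∈ P (α + n) := fun n => by
    induction n with
    | zero => simp
    | succ n ih =>
      intro α h
      rw [pow_succ, mul_assoc, ih, shift1]
      push_cast
      rw [add_assoc]
  have shiftz : ∀ (n : ℤ) α h, Mer.coord ^ n * h ∈ P α ↔ h ∈ P (α + n) := fun n α h => by
    obtain ⟨k, rfl | rfl⟩ := n.eq_nat_or_neg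
    · rw [zpow_natCast, shiftn]; simp
    · have h1 := shiftn k (α - k) (Mer.coord ^ (-k : ℤ) * h)
      rw [← mul_assoc, ← zpow_natCast, ← zpow_add₀ Mer.coord_ne_zero, add_neg_cancel, zpow_zero,
        one_mul, sub_add_cancel] at h1
      rw [← h1]
      push_cast
      rw [sub_eq_add_neg]
  -- Every nonzero germ is a power of `x` times a unit, so the filtration is determined by the steps
  -- that contain `1`. Monotonicity and right continuity make `S` a closed half-line, and `a` is
  -- minus its end point.
  set S : Set ℝ := {α | (1 : Mer) ∈ P α} with hS
  have unitz : ∀ (n : ℤ) (w : Mer) α, w ∈ Hol → w⁻¹ ∈ Hol → w ≠ 0 →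
      (Mer.coord ^ n * w ∈ P α ↔ α + n ∈ S) := fun n w α hw hw' h0 => by
    rw [shiftz]
    refine ⟨fun h => ?_, fun h => ?_⟩
    · have := hsmul hw' h
      rwa [inv_mul_cancel₀ h0] at this
    · have := hsmul hw h
      rwa [mul_one] at this
  have Sne : S.Nonempty := by
    obtain ⟨h, hh, h0⟩ := hne
    obtain ⟨n, w, hw, hw', hw0, rfl⟩ := Mer.exists_eq_zpow_mul h0
    exact ⟨_, (unitz n w 0 hw hw' hw0).1 hh⟩
  have Sbdd : BddBelow S := by
    obtain ⟨n, hn⟩ := hbdd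
    refine ⟨-(n + 1), fun α hα => ?_⟩
    -- If `1` lay in a step below `-(n+1)`, then `x^{-(n+1)}` would lie in step `0`, whose elements
    -- have poles of order at most `n`.
    by_contra! hlt
    have h1 : (1 : Mer) ∈ P (0 + (-(n + 1) : ℤ)) := mono (by push_cast; linarith) hα
    have h2 := hn _ ((shiftz _ 0 1).2 h1)
    rw [poleLE_zpow_mul, poleLE_one] at h2
    push_cast at h2
    linarith
  have Smem : ∀ α, α ∈ S ↔ sInf S ≤ α := fun α => by
    refine ⟨fun h => csInf_le Sbdd h, fun h => right_cont _ _ fun β hβ => ?_⟩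
    obtain ⟨γ, hγ, hlt⟩ := exists_lt_of_csInf_lt Sne (lt_of_le_of_lt h hβ)
    exact mono hlt.le hγ
  refine ⟨-sInf S, fun α h => ?_⟩
  by_cases h0 : h = 0
  · rw [h0]
    exact ⟨fun _ => PoleLE.zero _, fun _ => (P α).zero_mem⟩
  obtain ⟨n, w, hw, hw', hw0, rfl⟩ := Mer.exists_eq_zpow_mul h0
  rw [unitz n w α hw hw' hw0, Smem, poleLE_zpow_mul, poleLE_unit hw hw' hw0]
  constructor <;> intro <;> linarith

/-! ### Cyclic combinatorics -/

/-- Take `d_i = ∏_{j ≥ i} c_j`. The relation is immediate except where the cycle closes up, and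
there it says that the full product is `1`. -/
theorem exists_cyclic_rescaling {K : ℕ} (c : Fin K → ℂ) (hc : ∏ i, c i = 1) :
    ∃ d : Fin K → ℂ, (∀ i, d i ≠ 0) ∧ ∀ i, d i = c i * d (finRotate K i) := by
  rcases K with _ | n
  · exact ⟨c, fun i => i.elim0, fun i => i.elim0⟩
  have hc0 : ∀ i, c i ≠ 0 := fun i h => by
    rw [Finset.prod_eq_zero (Finset.mem_univ i) h] at hc
    exact zero_ne_one hc
  refine ⟨fun i => ∏ j ∈ Finset.Ici i, c j, fun i => Finset.prod_ne_zero_iff.2 fun j _ => hc0 j,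
    fun i => ?_⟩
  rw [finRotate_apply]
  dsimp only
  induction i using Fin.lastCases with
  | last =>
    have h1 : Finset.Ici (Fin.last n) = {Fin.last n} := by
      ext j; simp [Fin.last_le_iff]
    have h2 : Finset.Ici (0 : Fin (n + 1)) = Finset.univ := by
      ext j; simp
    rw [Fin.last_add_one, h1, h2, hc]
    simp
  | cast i =>
    have h1 : Finset.Ici i.castSucc = insert i.castSucc (Finset.Ici i.succ) := by
      ext j
      simp only [Finset.mem_Ici, Finset.mem_insert, Fin.le_def, Fin.ext_iff, Fin.val_castSucc,
        Fin.val_succ]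
      lia
    have h2 : i.castSucc + 1 = i.succ := by ext; simp
    rw [h2, h1, Finset.prod_insert]
    simp [Fin.le_def]

theorem val_finRotate_pow {n : ℕ} (k : ℕ) (i : Fin (n + 1)) :
    ((finRotate (n + 1) ^ k) i : ℕ) = (i + k) % (n + 1) := by
  induction k generalizing i with
  | zero => simp [Nat.mod_eq_of_lt i.2]
  | succ k ih =>
    rw [pow_succ', Equiv.Perm.mul_apply, finRotate_apply, Fin.val_add, ih, Fin.val_one',
      ← Nat.add_mod, add_assoc]

theorem finRotate_pow_val {n : ℕ} (i j : Fin (n + 1)) :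
    (finRotate (n + 1) ^ (j : ℕ)) i = i + j :=
  Fin.ext (by rw [val_finRotate_pow, Fin.val_add])

theorem exists_finRotate_pow {K : ℕ} (i j : Fin K) : ∃ k : ℕ, (finRotate K ^ k) i = j := by
  obtain ⟨n, rfl⟩ : ∃ n, K = n + 1 := ⟨K - 1, by have := i.2; lia⟩
  exact ⟨(j - i : Fin (n + 1)), by rw [finRotate_pow_val]; simp⟩

theorem finRotate_pow_self (K : ℕ) : finRotate K ^ K = 1 := by
  rcases K with _ | n
  · rfl
  · ext i
    rw [val_finRotate_pow]
    simp [Nat.mod_eq_of_lt i.2]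

theorem prod_finRotate_pow {R : Type*} [CommMonoid R] {K : ℕ} (p : Fin K → R) (i : Fin K) :
    ∏ l ∈ Finset.range K, p ((finRotate K ^ l) i) = ∏ j, p j := by
  obtain ⟨n, rfl⟩ : ∃ n, K = n + 1 := ⟨K - 1, by have := i.2; lia⟩
  rw [Finset.prod_range]
  simp only [finRotate_pow_val]
  exact Equiv.prod_comp (Equiv.addLeft i) p

/-- The difference `a - a'` is invariant under the rotation, hence constant, as there is a single
orbit; the equal sums make it zero. -/
theorem eq_of_cyclic_sub_eq {K : ℕ} {a a' : Fin K → ℝ}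
    (h : ∀ i, a i - a (finRotate K i) = a' i - a' (finRotate K i)) (hs : ∑ i, a i = ∑ i, a' i) :
    a = a' := by
  funext i
  have h1 : ∀ k : ℕ, a ((finRotate K ^ k) i) - a' ((finRotate K ^ k) i) = a i - a' i := fun k => by
    induction k with
    | zero => simp
    | succ k ih =>
      rw [pow_succ', Equiv.Perm.mul_apply]
      linarith [h ((finRotate K ^ k) i)]
  have h2 : ∀ j, a j - a' j = a i - a' i := fun j => by
    obtain ⟨k, rfl⟩ := exists_finRotate_pow i j
    exact h1 k
  have h3 : ∑ j, (a j - a' j) = 0 := by rw [Finset.sum_sub_distrib, hs, sub_self]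
  simp only [h2, Finset.sum_const, Finset.card_univ, Fintype.card_fin, nsmul_eq_mul] at h3
  have hK : (K : ℝ) ≠ 0 := Nat.cast_ne_zero.2 (by have := i.2; lia)
  rcases mul_eq_zero.1 h3 with h4 | h4
  · exact absurd h4 hK
  · linarith

theorem eq_parDeg {K N : ℕ} (b : OrderedPartition K N) {a : Fin K → ℝ}
    (h : ∀ i, a i - a (finRotate K i) = b.1 i - (N : ℝ) / K) (hs : ∑ i, a i = 0) :
    a = parDeg b :=
  eq_of_cyclic_sub_eq (fun i => by rw [h, parDeg_sub]) (by rw [hs, sum_parDeg])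

/-- Each step along the cycle adds `N/K` and subtracts the integer `b_i`. -/
theorem parDeg_finRotate_pow {K N : ℕ} (b : OrderedPartition K N) (k : ℕ) (i : Fin K) :
    ∃ n : ℤ, parDeg b ((finRotate K ^ k) i) = parDeg b i + k * (N / K : ℝ) + n := by
  induction k with
  | zero => exact ⟨0, by simp⟩
  | succ k ih =>
    obtain ⟨n, hn⟩ := ih
    refine ⟨n - b.1 ((finRotate K ^ k) i), ?_⟩
    have h := parDeg_sub b ((finRotate K ^ k) i)
    rw [pow_succ', Equiv.Perm.mul_apply, Nat.cast_succ, Int.cast_sub,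
      Int.cast_natCast]
    linarith

/-- Writing `j` as the `k`-th rotate of `i`, an integral difference makes `kN/K` an integer, so `K`
divides `k` by coprimality. -/
theorem eq_of_parDeg_sub_int {K N : ℕ} (hKN : Nat.Coprime K N) (b : OrderedPartition K N)
    {i j : Fin K} {n : ℤ} (h : parDeg b j = parDeg b i + n) : i = j := by
  have hK : (K : ℝ) ≠ 0 := Nat.cast_ne_zero.2 (by have := i.2; lia)
  obtain ⟨k, rfl⟩ := exists_finRotate_pow i j
  obtain ⟨m, hm⟩ := parDeg_finRotate_pow b k i
  have h1 : (k : ℝ) * N = (n - m) * K := by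
    have : (k : ℝ) * (N / K) = n - m := by linarith
    field_simp at this
    linarith
  have h2 : (K : ℤ) ∣ (k : ℤ) * N := ⟨n - m, by rw [mul_comm (K : ℤ)]; exact_mod_cast h1⟩
  have h3 : K ∣ k := hKN.dvd_of_dvd_mul_right (by exact_mod_cast h2)
  obtain ⟨l, rfl⟩ := h3
  rw [pow_mul, finRotate_pow_self, one_pow]
  rfl

theorem cyclic_of_parDeg_perm {K N : ℕ} [NeZero K] (hKN : Nat.Coprime K N)
    (b b' : OrderedPartition K N) (σ : Fin K → Fin K) (h : ∀ i, parDeg b' i = parDeg b (σ i)) :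
    b ≈ b' := by
  -- The degrees `α_{σ(i+1)}` and `α_{σ(i)+1}` are both `α_{σ(i)} + N/K` up to an integer, so the
  -- two indices agree. A map commuting with the rotation is a power of it.
  have hσ : ∀ i, σ (finRotate K i) = finRotate K (σ i) := fun i => by
    have h1 := parDeg_sub b (σ i)
    have h2 := parDeg_sub b' i
    rw [h, h] at h2
    refine eq_of_parDeg_sub_int hKN b (n := b'.1 i - b.1 (σ i)) ?_
    push_cast
    linarith
  have hb : ∀ i, b'.1 i = b.1 (σ i) := fun i => by
    have h1 := parDeg_sub b (σ i)
    have h2 := parDeg_sub b' i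
    rw [h, h, hσ] at h2
    have h3 : (b'.1 i : ℝ) = b.1 (σ i) := by linarith
    exact_mod_cast h3
  obtain ⟨k, hk⟩ := exists_finRotate_pow (0 : Fin K) (σ 0)
  refine ⟨k, fun i => ?_⟩
  rw [hb]
  refine congrArg b.1 ?_
  obtain ⟨l, rfl⟩ := exists_finRotate_pow (0 : Fin K) i
  rw [← Equiv.Perm.mul_apply, ← pow_add, add_comm, pow_add, Equiv.Perm.mul_apply, hk]
  clear hk
  induction l with
  | zero => rfl
  | succ l ih => rw [pow_succ', Equiv.Perm.mul_apply, Equiv.Perm.mul_apply, hσ, ih]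

instance (K N : ℕ) : Finite (OrderedPartition K N) := by
  have h : ∀ b : OrderedPartition K N, ∀ i, b.1 i < N + 1 := fun b i => by
    have := Finset.single_le_sum (f := b.1) (fun _ _ => Nat.zero_le _) (Finset.mem_univ i)
    rw [b.2] at this
    lia
  refine Finite.of_injective (fun b i => (⟨b.1 i, h b i⟩ : Fin (N + 1))) fun b b' hb => ?_
  exact Subtype.ext (funext fun i => Fin.val_eq_of_eq (congrFun hb i))

/-! ### Adapted bases -/

/-- A basis of global sections splitting the filtered bundle as `⨁ 𝒪(a_i)`. -/
def IsAdapted {K : ℕ} (E : FilteredBundle K) (e : Module.Basis (Fin K) ℂ[X] E.Sec)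
    (a : Fin K → ℝ) : Prop :=
  ∀ β v, v ∈ E.filt β ↔ ∀ i, PoleLE ((Algebra.TensorProduct.basis Mer e).repr v i) (a i + β)

theorem sumO_isAdapted {K : ℕ} (a : Fin K → ℝ) :
    IsAdapted (sumO a) (Pi.basisFun ℂ[X] (Fin K)) a := fun _ _ => Iff.rfl

theorem isFilteredIso_of_isAdapted {K : ℕ} {E F : FilteredBundle K}
    {e : Module.Basis (Fin K) ℂ[X] E.Sec} {f : Module.Basis (Fin K) ℂ[X] F.Sec} {a : Fin K → ℝ}
    (he : IsAdapted E e a) (hf : IsAdapted F f a) {g : E.Sec ≃ₗ[ℂ[X]] F.Sec}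
    (hg : ∀ i, g (e i) = f i) : IsFilteredIso g := by
  have h : ∀ v : E.Stalk, (Algebra.TensorProduct.basis Mer f).repr (g.toLinearMap.baseChange Mer v) =
      (Algebra.TensorProduct.basis Mer e).repr v := fun v => by
    have : ((Algebra.TensorProduct.basis Mer f).repr.toLinearMap ∘ₗ g.toLinearMap.baseChange Mer) =
        (Algebra.TensorProduct.basis Mer e).repr.toLinearMap := by
      refine (Algebra.TensorProduct.basis Mer e).ext fun i => ?_
      rw [LinearMap.comp_apply, Algebra.TensorProduct.basis_apply, LinearMap.baseChange_tmul]
      simp only [LinearEquiv.coe_coe, hg]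
      rw [← Algebra.TensorProduct.basis_apply, ← Algebra.TensorProduct.basis_apply,
        Module.Basis.repr_self, Module.Basis.repr_self]
    exact LinearMap.congr_fun this v
  intro α v
  rw [he, hf]
  simp only [h]

theorem IsAdapted.reindex {K : ℕ} {E : FilteredBundle K} {e : Module.Basis (Fin K) ℂ[X] E.Sec}
    {a : Fin K → ℝ} (he : IsAdapted E e a) (σ : Equiv.Perm (Fin K)) :
    IsAdapted E (e.reindex σ.symm) (a ∘ σ) := by
  have h : ∀ (v : E.Stalk) i, (Algebra.TensorProduct.basis Mer (e.reindex σ.symm)).repr v i =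
      (Algebra.TensorProduct.basis Mer e).repr v (σ i) := fun v i => by
    have : Algebra.TensorProduct.basis Mer (e.reindex σ.symm) =
        (Algebra.TensorProduct.basis Mer e).reindex σ.symm := by
      ext i
      simp [Algebra.TensorProduct.basis_apply]
    rw [this, Module.Basis.repr_reindex_apply, Equiv.symm_symm]
  intro β v
  rw [he]
  simp only [h, Function.comp_apply]
  exact σ.forall_congr_right.symm

theorem IsAdapted.smul {K : ℕ} {E : FilteredBundle K} {e e' : Module.Basis (Fin K) ℂ[X] E.Sec}
    {a : Fin K → ℝ} (he : IsAdapted E e a) {d : Fin K → ℂ} (hd : ∀ i, d i ≠ 0)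
    (h : ∀ i, e' i = C (d i) • e i) : IsAdapted E e' a := by
  have h : ∀ (v : E.Stalk) i, (Algebra.TensorProduct.basis Mer e).repr v i =
      const (d i) * (Algebra.TensorProduct.basis Mer e').repr v i := fun v i => by
    conv_lhs => rw [← (Algebra.TensorProduct.basis Mer e').sum_repr v]
    simp only [Algebra.TensorProduct.basis_apply, h, TensorProduct.tmul_smul]
    simp only [← Algebra.TensorProduct.basis_apply, algebra_compatible_smul Mer (C _),
      algebraMap_C, map_sum, map_smul, Module.Basis.repr_self]
    rw [Finset.sum_apply', Finset.sum_eq_single i]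
    · simp [mul_comm]
    · intro j _ hj
      simp [hj]
    · simp
  intro β v
  rw [he]
  simp only [h, poleLE_const_mul (hd _)]

theorem rotBasis_apply {ι : Type*} (c : ℂˣ) (M : Type) [AddCommGroup M] [Module ℂ[X] M]
    (b : Module.Basis ι ℂ[X] M) (i : ι) : rotBasis c M b i = toRot c M (b i) :=
  semiBasis_apply _ _ _ _ i

theorem IsAdapted.rot {K : ℕ} {E : FilteredBundle K} {e : Module.Basis (Fin K) ℂ[X] E.Sec}
    {a : Fin K → ℝ} (he : IsAdapted E e a) (c : ℂˣ) :
    IsAdapted (E.rot c) (rotBasis c E.Sec e) a := by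
  have h : ∀ (v : E.Stalk) i,
      (Algebra.TensorProduct.basis Mer (rotBasis c E.Sec e)).repr (rotStalk c E.Sec v) i =
      Mer.rot c⁻¹ ((Algebra.TensorProduct.basis Mer e).repr v i) := fun v i => by
    have : rotStalk c E.Sec v = ∑ i, Mer.rot c⁻¹ ((Algebra.TensorProduct.basis Mer e).repr v i) •
        Algebra.TensorProduct.basis Mer (rotBasis c E.Sec e) i := by
      conv_lhs => rw [← (Algebra.TensorProduct.basis Mer e).sum_repr v]
      simp only [map_sum, rotStalk_smul, Algebra.TensorProduct.basis_apply, rotStalk_tmul, map_one]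
      exact Finset.sum_congr rfl fun i _ => by rw [rotBasis_apply]
    rw [this]
    simp [map_sum, map_smul, Finset.sum_apply', Finsupp.single_apply]
  intro β v
  obtain ⟨w, rfl⟩ := (rotStalk c E.Sec).surjective v
  have h1 : rotStalk c E.Sec w ∈ (E.rot c).filt β ↔ w ∈ E.filt β := by
    refine (mem_rotSubmodule c E.Sec (E.filt β) _).trans ?_
    rw [AddEquiv.symm_apply_apply]
  refine h1.trans ((he β w).trans (forall_congr' fun i => ?_))
  rw [← poleLE_rot c⁻¹, ← h w i]
  rfl

/-- The normal form of a filtered Higgs bundle split by sections which the Higgs field permutes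
cyclically up to monomials. -/
theorem higgsIso_higgsOf {K N : ℕ} {b : OrderedPartition K N} {E : FilteredHiggs K}
    {e : Module.Basis (Fin K) ℂ[X] E.Sec} (he : IsAdapted E.toFilteredBundle e (parDeg b))
    {c : Fin K → ℂ} (hc : ∏ i, c i = 1)
    (hphi : ∀ i, E.phi (e (finRotate K i)) = (C (c i) * X ^ b.1 i) • e i) :
    HiggsIso E (higgsOf b) := by
  -- The sections `d_i e_i` absorb the constants `c_i`, and constants do not affect the filtration.
  obtain ⟨d, hd, hdc⟩ := exists_cyclic_rescaling c hc
  have hu : ∀ i, IsUnit (C (d i)) := fun i => isUnit_C.2 (hd i).isUnit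
  set e' := e.isUnitSMul hu
  have he' : ∀ i, e' i = C (d i) • e i := fun i => e.isUnitSMul_apply hu i
  have had := he.smul hd he'
  have hphi' : ∀ i, E.phi (e' (finRotate K i)) = (X ^ b.1 i : ℂ[X]) • e' i := fun i => by
    rw [he', he', map_smul, hphi, smul_smul, smul_smul, hdc i, C_mul]
    congr 1
    ring
  have hg : ∀ i, e'.equivFun (e' i) = Pi.basisFun ℂ[X] (Fin K) i := fun i => by
    ext1 j
    rw [Module.Basis.equivFun_apply, Module.Basis.repr_self, Finsupp.single_apply]
    simp [Pi.single_apply, eq_comm]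
  refine ⟨e'.equivFun, isFilteredIso_of_isAdapted had (sumO_isAdapted (parDeg b)) hg, fun s => ?_⟩
  have key : e'.equivFun.toLinearMap ∘ₗ E.phi =
      (Matrix.toLin' (cyclicMatrix b)) ∘ₗ e'.equivFun.toLinearMap := by
    refine e'.ext fun i => ?_
    obtain ⟨i, rfl⟩ := (finRotate K).surjective i
    simp only [LinearMap.comp_apply, LinearEquiv.coe_coe, hphi', map_smul, hg, Pi.basisFun_apply,
      Matrix.toLin'_apply, Matrix.mulVec_single_one]
    ext1 j
    by_cases hj : j = i
    · subst hj
      simp [cyclicMatrix]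
    · have : finRotate K i ≠ finRotate K j := fun h => hj ((finRotate K).injective h).symm
      simp only [cyclicMatrix, Matrix.col_apply, Matrix.of_apply, this, if_false, Pi.smul_apply,
        Pi.single_apply, hj, smul_zero]
  exact LinearMap.congr_fun key s

theorem higgsOf_phi_basisFun {K N : ℕ} (b : OrderedPartition K N) (i : Fin K) :
    (higgsOf b).phi (Pi.basisFun ℂ[X] (Fin K) (finRotate K i)) =
      (X ^ b.1 i : ℂ[X]) • Pi.basisFun ℂ[X] (Fin K) i := by
  change Matrix.toLin' (cyclicMatrix b) _ = _
  rw [Pi.basisFun_apply, Pi.basisFun_apply, Matrix.toLin'_apply, Matrix.mulVec_single_one]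
  ext1 j
  by_cases hj : j = i
  · subst hj
    simp [cyclicMatrix]
  · have : finRotate K i ≠ finRotate K j := fun h => hj ((finRotate K).injective h).symm
    simp only [cyclicMatrix, Matrix.col_apply, Matrix.of_apply, this, if_false, Pi.smul_apply,
      Pi.single_apply, hj, smul_zero]

/-- Relabelling the basis sections by a power of the rotation carries one normal form to the other;
the degrees follow because they are determined by their cyclic differences and their sum. -/
theorem higgsIso_of_cyclic {K N : ℕ} {b b' : OrderedPartition K N} (h : b ≈ b') :
    HiggsIso (higgsOf b) (higgsOf b') := by
  obtain ⟨k, hk⟩ := h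
  set σ := finRotate K ^ k
  have hσ : ∀ i, σ (finRotate K i) = finRotate K (σ i) := fun i => by
    rw [← Equiv.Perm.mul_apply, ← Equiv.Perm.mul_apply, ← pow_succ, ← pow_succ']
  have had := (sumO_isAdapted (parDeg b)).reindex σ
  have hdeg : parDeg b ∘ σ = parDeg b' := by
    refine eq_parDeg b' (fun i => ?_) ?_
    · rw [Function.comp_apply, Function.comp_apply, hσ, parDeg_sub, hk]
    · rw [← sum_parDeg b]
      exact Equiv.sum_comp σ (parDeg b)
  rw [hdeg] at had
  refine higgsIso_higgsOf (E := higgsOf b) had (c := fun _ => 1) (by simp) fun i => ?_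
  have h1 : ∀ j, (Module.Basis.reindex (Pi.basisFun ℂ[X] (Fin K)) σ.symm) j =
      Pi.basisFun ℂ[X] (Fin K) (σ j) := fun j => by
    rw [Module.Basis.reindex_apply, Equiv.symm_symm]
  have h2 := higgsOf_phi_basisFun b (σ i)
  rw [← hσ, ← h1, ← h1, ← hk, ← one_mul (X ^ _), ← C_1] at h2
  exact h2

theorem higgsIso_act_higgsOf {K N : ℕ} (hKN : 0 < K) (t : ℂ) (b : OrderedPartition K N) :
    HiggsIso ((higgsOf b).act N t) (higgsOf b) := by
  set c := rotFactor K N t with hc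
  have had := (sumO_isAdapted (parDeg b)).rot c
  refine higgsIso_higgsOf (E := (higgsOf b).act N t) had
    (c := fun i => Complex.exp t * c * (c : ℂ) ^ b.1 i) ?_ fun i => ?_
  -- The product of the constants is `(e^t c)^K c^N = e^{Kt} c^{K+N}`, which is `1` for `c =
  -- e^{-Kt/(K+N)}`. This is why `ρ_t` is normalised in this way.
  · rw [Finset.prod_mul_distrib, Finset.prod_const, Finset.card_univ, Fintype.card_fin,
      Finset.prod_pow_eq_pow_sum, b.2, mul_pow, mul_assoc, ← pow_add, hc, rotFactor, Units.val_mk0,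
      ← Complex.exp_nat_mul, ← Complex.exp_nat_mul, ← Complex.exp_add, Complex.exp_eq_one_iff]
    refine ⟨0, ?_⟩
    have : (K : ℂ) + N ≠ 0 := by exact_mod_cast (by lia : K + N ≠ 0)
    push_cast
    field_simp
    ring
  · have h1 : ∀ j, rotBasis c (sumO (parDeg b)).Sec (Pi.basisFun ℂ[X] (Fin K)) j =
        toRot c (sumO (parDeg b)).Sec (Pi.basisFun ℂ[X] (Fin K) j) :=
      fun j => rotBasis_apply _ _ _ j
    have h2 : rotMap c (higgsOf b).phi (rotBasis c (sumO (parDeg b)).Sec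
        (Pi.basisFun ℂ[X] (Fin K)) (finRotate K i)) = (C ((c : ℂ) ^ b.1 i) * X ^ b.1 i : ℂ[X]) •
        rotBasis c (sumO (parDeg b)).Sec (Pi.basisFun ℂ[X] (Fin K)) i := by
      rw [h1, h1]
      change toRot c _ ((higgsOf b).phi (Pi.basisFun ℂ[X] (Fin K) (finRotate K i))) = _
      rw [higgsOf_phi_basisFun]
      refine (toRot_smul c _ _ _).trans ?_
      congr 1
      simp [polyRot, mul_pow]
    refine (congrArg (fun x => (C (Complex.exp t * c) : ℂ[X]) • x) h2).trans ?_
    refine (smul_smul _ _ _).trans (congrArg (· • _) ?_)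
    simp only [C_mul]
    ring

theorem IsAdapted.tmul_mem {K : ℕ} {E : FilteredBundle K} {e : Module.Basis (Fin K) ℂ[X] E.Sec}
    {a : Fin K → ℝ} (he : IsAdapted E e a) (i : Fin K) {β : ℝ} (hβ : 0 ≤ a i + β) :
    (1 : Mer) ⊗ₜ[ℂ[X]] e i ∈ E.filt β := by
  rw [he]
  intro j
  rw [← Algebra.TensorProduct.basis_apply, Module.Basis.repr_self, Finsupp.single_apply]
  split_ifs with h
  · subst h
    exact poleLE_one.2 hβ
  · exact PoleLE.zero _

/-- A filtered bundle determines the multiset of the parabolic degrees of its line subbundles. -/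
theorem exists_perm_of_isFilteredIso {K : ℕ} {E F : FilteredBundle K}
    {e : Module.Basis (Fin K) ℂ[X] E.Sec} {f : Module.Basis (Fin K) ℂ[X] F.Sec}
    {a a' : Fin K → ℝ} (he : IsAdapted E e a) (hf : IsAdapted F f a')
    (hs : ∑ i, a i = ∑ i, a' i) {g : E.Sec ≃ₗ[ℂ[X]] F.Sec} (hg : IsFilteredIso g) :
    ∃ σ : Equiv.Perm (Fin K), ∀ i, a' (σ i) = a i := by
  set A := LinearMap.toMatrix e f g.toLinearMap with hA
  have hdet : A.det ≠ 0 := by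
    have h1 : LinearMap.toMatrix f e g.symm.toLinearMap * A = 1 := by
      rw [hA, ← LinearMap.toMatrix_comp]
      simp
    intro h0
    have h2 := congrArg Matrix.det h1
    rw [Matrix.det_mul, h0, mul_zero, Matrix.det_one] at h2
    exact zero_ne_one h2
  -- The determinant of the polynomial matrix of `g` is nonzero, so some term of its Leibniz
  -- expansion is.
  obtain ⟨σ, hσ⟩ : ∃ σ : Equiv.Perm (Fin K), ∏ i, A (σ i) i ≠ 0 := by
    by_contra! h
    exact hdet (by rw [Matrix.det_apply]; simp [h])
  -- The section `e_i` has order `-a_i`, so a nonzero entry `A (σ i) i` is a polynomial of degree at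
  -- most `a'_{σ i} - a_i`. As the sums of the degrees agree, all these nonnegative numbers vanish.
  have hle : ∀ i, 0 ≤ a' (σ i) - a i := fun i => by
    have h1 : A (σ i) i ≠ 0 := Finset.prod_ne_zero_iff.1 hσ i (Finset.mem_univ i)
    have h2 := (hg (-a i) _).1 (he.tmul_mem i (β := -a i) (by simp))
    rw [LinearMap.baseChange_tmul, hf] at h2
    have h3 := h2 (σ i)
    rw [Algebra.TensorProduct.basis_repr_tmul, Finsupp.smul_apply, Finsupp.mapRange_apply,
      smul_eq_mul, one_mul] at h3
    have h4 := natDegree_le_of_poleLE (p := A (σ i) i) h1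
      (by rw [hA, LinearMap.toMatrix_apply]; exact h3)
    have h5 : (0 : ℝ) ≤ (A (σ i) i).natDegree := Nat.cast_nonneg _
    linarith
  have hsum : ∑ i, (a' (σ i) - a i) = 0 := by
    rw [Finset.sum_sub_distrib, Equiv.sum_comp σ a', hs, sub_self]
  refine ⟨σ, fun i => ?_⟩
  have := (Finset.sum_eq_zero_iff_of_nonneg fun i _ => hle i).1 hsum i (Finset.mem_univ i)
  linarith

/-- Only the filtered bundles are compared, not the Higgs fields; the statement on strata depends on
this. -/
theorem cyclic_of_isFilteredIso {K N : ℕ} [NeZero K] (hKN : Nat.Coprime K N)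
    {b b' : OrderedPartition K N} {g : (sumO (parDeg b)).Sec ≃ₗ[ℂ[X]] (sumO (parDeg b')).Sec}
    (hg : IsFilteredIso g) : b ≈ b' := by
  obtain ⟨σ, hσ⟩ := exists_perm_of_isFilteredIso (sumO_isAdapted _) (sumO_isAdapted _)
    (by rw [sum_parDeg, sum_parDeg]) hg
  exact Setoid.symm (cyclic_of_parDeg_perm hKN b' b σ fun i => (hσ i).symm)

/-! ### Determinants -/

theorem PoleLE.prod {ι : Type*} (s : Finset ι) {a : ι → Mer} {β : ι → ℝ}
    (h : ∀ i ∈ s, PoleLE (a i) (β i)) : PoleLE (∏ i ∈ s, a i) (∑ i ∈ s, β i) := by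
  classical
  induction s using Finset.induction_on with
  | empty => simpa using poleLE_one.2 le_rfl
  | insert i s hi ih =>
    rw [Finset.prod_insert hi, Finset.sum_insert hi]
    exact PoleLE.mul (h i (Finset.mem_insert_self i s))
      (ih fun j hj => h j (Finset.mem_insert_of_mem hj))

/-- The top exterior power is free of rank one. It is enough to compare on families `e ∘ v` with `v`
injective, where `v` is a permutation and both sides change by its sign. -/
theorem exteriorPower_eq_det_smul {R M : Type*} [CommRing R] [AddCommGroup M] [Module R M] {K : ℕ}
    (e : Module.Basis (Fin K) R M) (ω : ⋀[R]^K M) :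
    ω = exteriorPower.alternatingMapLinearEquiv e.det ω • exteriorPower.ιMulti R K e := by
  have h : LinearMap.id = (LinearMap.toSpanSingleton R _ (exteriorPower.ιMulti R K e)) ∘ₗ
      exteriorPower.alternatingMapLinearEquiv e.det := by
    refine exteriorPower.linearMap_ext (Module.Basis.ext_alternating e fun v hv => ?_)
    set σ := Equiv.ofBijective v (Finite.injective_iff_bijective.1 hv)
    have hσ : (fun i => e (v i)) = e ∘ σ := rfl
    rw [hσ, AlternatingMap.map_perm, AlternatingMap.map_perm]
    congr 1
    simp only [LinearMap.compAlternatingMap_apply, LinearMap.id_apply, LinearMap.comp_apply,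
      exteriorPower.alternatingMapLinearEquiv_apply_ιMulti, LinearMap.toSpanSingleton_apply,
      Module.Basis.det_self, one_smul]
  exact LinearMap.congr_fun h ω

theorem det_ιMulti_self {R M : Type*} [CommRing R] [AddCommGroup M] [Module R M] {K : ℕ}
    (e : Module.Basis (Fin K) R M) :
    exteriorPower.alternatingMapLinearEquiv e.det (exteriorPower.ιMulti R K e) = 1 := by
  rw [exteriorPower.alternatingMapLinearEquiv_apply_ιMulti, Module.Basis.det_self]

theorem wedgeGerm_ιMulti {K : ℕ} (E : FilteredBundle K) (s : Fin K → E.Sec) :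
    wedgeGerm E (exteriorPower.ιMulti ℂ[X] K s) =
      exteriorPower.ιMulti Mer K fun i => (1 : Mer) ⊗ₜ[ℂ[X]] s i := by
  rw [wedgeGerm, exteriorPower.alternatingMapLinearEquiv_apply_ιMulti]
  rfl

/-- The determinant in the adapted basis bounds the order from below: by the Leibniz formula it has
a pole of order at most `∑ a_i + α` on every generator of step `α`, and it is `1` on the basis. -/
theorem wedgeGerm_mem_iff {K : ℕ} [NeZero K] {E : FilteredBundle K}
    {e : Module.Basis (Fin K) ℂ[X] E.Sec} {a : Fin K → ℝ} (he : IsAdapted E e a) {c : ℂ}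
    (hc : c ≠ 0) (α : ℝ) :
    wedgeGerm E (C c • exteriorPower.ιMulti ℂ[X] K e) ∈ wedgeFilt E α ↔ 0 ≤ ∑ i, a i + α := by
  set f := Algebra.TensorProduct.basis Mer e with hf
  have hω : wedgeGerm E (C c • exteriorPower.ιMulti ℂ[X] K e) =
      const c • exteriorPower.ιMulti Mer K f := by
    rw [map_smul, wedgeGerm_ιMulti, algebra_compatible_smul Mer, algebraMap_C]
    congr 2
    funext i
    rw [hf, Algebra.TensorProduct.basis_apply]
  rw [hω]
  constructor
  · intro h
    have key : ∀ w ∈ wedgeFilt E α,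
        PoleLE (exteriorPower.alternatingMapLinearEquiv f.det w) (∑ i, a i + α) := by
      intro w hw
      induction hw using Submodule.span_induction with
      | mem w hw =>
        obtain ⟨s, β, hs, hβ, rfl⟩ := hw
        rw [exteriorPower.alternatingMapLinearEquiv_apply_ιMulti, Module.Basis.det_apply,
          Matrix.det_apply]
        refine PoleLE.sum fun σ _ => ?_
        have h1 : PoleLE (∏ i, f.toMatrix s (σ i) i) (∑ i, a i + α) := by
          rw [← hβ, ← Equiv.sum_comp σ a, ← Finset.sum_add_distrib]
          exact PoleLE.prod _ fun i _ => (he _ _).1 (hs i) (σ i)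
        rcases Int.units_eq_one_or (Equiv.Perm.sign σ) with h2 | h2
        · rwa [h2, one_smul]
        · rw [h2, Units.neg_smul, one_smul, PoleLE, mul_neg]
          exact Hol.neg_mem h1
      | zero => rw [map_zero]; exact PoleLE.zero _
      | add x y _ _ hx hy => rw [map_add]; exact PoleLE.add hx hy
      | smul h x _ hx =>
        change PoleLE (exteriorPower.alternatingMapLinearEquiv f.det ((h : Mer) • x)) _
        rw [map_smul]
        exact PoleLE.hol_mul h.2 hx
    have h1 := key _ h
    rwa [map_smul, det_ιMulti_self, smul_eq_mul, poleLE_const_mul hc, poleLE_one] at h1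
  · intro h
    have h1 : exteriorPower.ιMulti Mer K f ∈ wedgeFilt E α := by
      -- The orders `-a_i` may sum to less than `α`; the slack `∑ a_i + α ≥ 0` is shared equally
      -- among the `K` factors.
      refine Submodule.subset_span ⟨f, fun i => -a i + (∑ i, a i + α) / K, fun i => ?_, ?_, rfl⟩
      · rw [hf, Algebra.TensorProduct.basis_apply]
        refine he.tmul_mem i ?_
        have : 0 ≤ (∑ i, a i + α) / K := by positivity
        linarith
      · rw [Finset.sum_add_distrib, Finset.sum_neg_distrib, Finset.sum_const, Finset.card_univ,
          Fintype.card_fin, nsmul_eq_mul, mul_div_cancel₀ _ (Nat.cast_ne_zero.2 (NeZero.ne K))]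
        ring
    exact (wedgeFilt E α).smul_mem (⟨const c, const_mem_hol c⟩ : Hol) h1

theorem wedgeOrder_eq {K : ℕ} [NeZero K] {E : FilteredBundle K}
    {e : Module.Basis (Fin K) ℂ[X] E.Sec} {a : Fin K → ℝ} (he : IsAdapted E e a) {c : ℂ}
    (hc : c ≠ 0) :
    wedgeOrder E (C c • exteriorPower.ιMulti ℂ[X] K e) = ((-∑ i, a i : ℝ) : EReal) := by
  refine IsLeast.csInf_eq ⟨⟨_, (wedgeGerm_mem_iff he hc _).2 (by simp), rfl⟩, ?_⟩
  rintro _ ⟨α, hα, rfl⟩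
  rw [wedgeGerm_mem_iff he hc] at hα
  exact EReal.coe_le_coe_iff.2 (by linarith)

/-- A trivialising section is a unit of `ℂ[X]`, that is a nonzero constant, times `e_1 ∧ ⋯ ∧ e_K`,
whose order is `-∑ a_i`. -/
theorem sum_eq_zero_of_slStructure {K : ℕ} [NeZero K] {E : FilteredBundle K}
    {e : Module.Basis (Fin K) ℂ[X] E.Sec} {a : Fin K → ℝ} (he : IsAdapted E e a)
    (S : SLStructure E) : ∑ i, a i = 0 := by
  have h1 : exteriorPower.ιMulti ℂ[X] K e ∈ Submodule.span ℂ[X] {S.ω} := by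
    rw [S.trivializes]; trivial
  obtain ⟨q, hq⟩ := Submodule.mem_span_singleton.1 h1
  have h2 := congrArg (exteriorPower.alternatingMapLinearEquiv e.det) hq
  rw [map_smul, det_ιMulti_self, smul_eq_mul] at h2
  obtain ⟨c, hc, hc'⟩ := Polynomial.isUnit_iff.1 (IsUnit.of_mul_eq_one_right _ h2)
  have h3 := exteriorPower_eq_det_smul e S.ω
  rw [← hc'] at h3
  have h4 := S.order_eq
  rw [h3, wedgeOrder_eq he hc.ne_zero] at h4
  have h5 : -∑ i, a i = 0 := by exact_mod_cast h4
  linarith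

/-- The `SL(K)`-structure of `⨁ 𝒪(a_i)` when `∑ a_i = 0`. -/
noncomputable def slStructureSumO {K : ℕ} [NeZero K] {a : Fin K → ℝ} (ha : ∑ i, a i = 0) :
    SLStructure (sumO a) where
  ω := exteriorPower.ιMulti ℂ[X] K (Pi.basisFun ℂ[X] (Fin K))
  trivializes := by
    rw [eq_top_iff]
    intro ω _
    rw [Submodule.mem_span_singleton]
    exact ⟨_, (exteriorPower_eq_det_smul (Pi.basisFun ℂ[X] (Fin K)) ω).symm⟩
  order_eq := by
    have h := wedgeOrder_eq (sumO_isAdapted a) (one_ne_zero (α := ℂ))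
    rw [C_1, one_smul, ha, neg_zero, EReal.coe_zero] at h
    exact h

/-! ### The pulled back filtration -/

/-- The basis of `ψ^* ℰ` given by a basis of global sections of `ℰ`. -/
noncomputable def pullBasis (m : ℕ) [NeZero m] {K : ℕ} {E : FilteredBundle K}
    (e : Module.Basis (Fin K) ℂ[X] E.Sec) : Module.Basis (Fin K) (Cover m) (PullStalk m E) :=
  Algebra.TensorProduct.basis (Cover m) (Algebra.TensorProduct.basis Mer e)

theorem pullBasis_repr_tmul (m : ℕ) [NeZero m] {K : ℕ} {E : FilteredBundle K}
    (e : Module.Basis (Fin K) ℂ[X] E.Sec) (f : Cover m) (s : E.Stalk) (i : Fin K) :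
    (pullBasis m e).repr (f ⊗ₜ[Mer] s) i =
      f * algebraMap Mer (Cover m) ((Algebra.TensorProduct.basis Mer e).repr s i) := by
  rw [pullBasis, Algebra.TensorProduct.basis_repr_tmul]
  rfl

theorem pullBasis_apply (m : ℕ) [NeZero m] {K : ℕ} {E : FilteredBundle K}
    (e : Module.Basis (Fin K) ℂ[X] E.Sec) (i : Fin K) :
    pullBasis m e i = (1 : Cover m) ⊗ₜ[Mer] ((1 : Mer) ⊗ₜ[ℂ[X]] e i) := by
  rw [pullBasis, Algebra.TensorProduct.basis_apply, Algebra.TensorProduct.basis_apply]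

/-- Pulling back `𝒪(a_i)` multiplies its degree by `m`, and an adapted basis stays adapted on the
cover. -/
theorem mem_pullFilt_iff (m : ℕ) [NeZero m] {K : ℕ} {E : FilteredBundle K}
    {e : Module.Basis (Fin K) ℂ[X] E.Sec} {a : Fin K → ℝ} (he : IsAdapted E e a) (β : ℝ)
    (v : PullStalk m E) :
    v ∈ pullFilt m E β ↔ ∀ i, PoleLE ((pullBasis m e).repr v i) (m * a i + β) := by
  constructor
  · intro hv i
    induction hv using Submodule.span_induction with
    | mem v hv =>
      obtain ⟨k, α, s, hs, hβ, rfl⟩ := hv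
      rw [pullBasis_repr_tmul]
      change PoleLE (coord ^ (-k) * powPull m ((Algebra.TensorProduct.basis Mer e).repr s i)) _
      rw [poleLE_zpow_mul]
      refine PoleLE.mono ?_ (PoleLE.powPull m ((he α s).1 hs i))
      have h1 : (m : ℝ) * ⌊a i + α⌋ ≤ m * (a i + α) :=
        mul_le_mul_of_nonneg_left (Int.floor_le _) (Nat.cast_nonneg _)
      push_cast
      linarith
    | zero => rw [map_zero]; exact PoleLE.zero _
    | add x y _ _ hx hy => rw [map_add]; exact PoleLE.add hx hy
    | smul h x _ hx =>
      change PoleLE ((pullBasis m e).repr ((h : Cover m) • x) i) _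
      rw [map_smul]
      exact PoleLE.hol_mul h.2 hx
  · intro hv
    rw [← (pullBasis m e).sum_repr v]
    refine Submodule.sum_mem _ fun i _ => ?_
    -- The coordinate `v_i` is `u^{-p}` times a holomorphic germ, and `u^{-p} ⊗ e_i` is a generator:
    -- `e_i` has order `-a_i` and `p - m a_i ≤ β`.
    set p := ⌊m * a i + β⌋ with hp
    have h1 : ((uCoord m) ^ (-p) : Cover m) ⊗ₜ[Mer] ((1 : Mer) ⊗ₜ[ℂ[X]] e i) ∈ pullFilt m E β := by
      refine Submodule.subset_span ⟨p, -a i, _, he.tmul_mem i (by simp), ?_, rfl⟩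
      have := Int.floor_le (m * a i + β)
      linarith
    have h2 := (pullFilt m E β).smul_mem (⟨_, hv i⟩ : HolCover m) h1
    convert h2 using 1
    refine Eq.trans ?_ (show (((uCoord m) ^ p : Cover m) * (pullBasis m e).repr v i) •
      (((uCoord m) ^ (-p) : Cover m) ⊗ₜ[Mer] ((1 : Mer) ⊗ₜ[ℂ[X]] e i) : PullStalk m E) = _ from rfl)
    rw [TensorProduct.smul_tmul', smul_eq_mul, mul_right_comm, ← zpow_add₀, add_neg_cancel,
      zpow_zero, one_mul, pullBasis_apply, TensorProduct.smul_tmul', smul_eq_mul, mul_one]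
    exact coord_ne_zero

/-- A polynomial in `z`, as a germ on the cover. -/
noncomputable def polyCover (m : ℕ) [NeZero m] (p : ℂ[X]) : Cover m :=
  algebraMap Mer (Cover m) (algebraMap ℂ[X] Mer p)

theorem polyCover_injective (m : ℕ) [NeZero m] : Function.Injective (polyCover m) :=
  (RingHom.injective (algebraMap Mer (Cover m))).comp algebraMap_poly_injective

theorem polyCover_leading_term (m : ℕ) [NeZero m] {p : ℂ[X]} (hp : p ≠ 0) : ∃ w ∈ oneUnits,
    polyCover m p = (const p.leadingCoeff * (coord ^ (-(m * p.natDegree) : ℤ) * w) : Mer) := by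
  obtain ⟨w, hw, h⟩ := exists_leading_term hp
  refine ⟨powPull m w, powPull_oneUnits m hw, ?_⟩
  change powPull m (algebraMap ℂ[X] Mer p) = _
  rw [h, map_mul, map_mul, powPull_const, powPull_zpow_coord, mul_neg]

theorem polyCover_smul (m : ℕ) [NeZero m] {K : ℕ} {E : FilteredBundle K} (p : ℂ[X]) (s : E.Sec) :
    (1 : Cover m) ⊗ₜ[Mer] ((1 : Mer) ⊗ₜ[ℂ[X]] (p • s)) =
      polyCover m p • ((1 : Cover m) ⊗ₜ[Mer] ((1 : Mer) ⊗ₜ[ℂ[X]] s)) := by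
  rw [TensorProduct.tmul_smul, algebra_compatible_smul Mer p, TensorProduct.tmul_smul,
    algebra_compatible_smul (Cover m) (algebraMap ℂ[X] Mer p)]
  rfl

theorem pullPhi_tmul (m : ℕ) [NeZero m] {K : ℕ} (E : FilteredHiggs K) (s : E.Sec) :
    pullPhi m E ((1 : Cover m) ⊗ₜ[Mer] ((1 : Mer) ⊗ₜ[ℂ[X]] s)) =
      (1 : Cover m) ⊗ₜ[Mer] ((1 : Mer) ⊗ₜ[ℂ[X]] E.phi s) := by
  rw [pullPhi, LinearMap.baseChange_tmul, LinearMap.baseChange_tmul]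

theorem eq_zero_of_pull_tmul_eq_zero (m : ℕ) [NeZero m] {K : ℕ} (E : FilteredBundle K) {s : E.Sec}
    (hs : (1 : Cover m) ⊗ₜ[Mer] ((1 : Mer) ⊗ₜ[ℂ[X]] s) = (0 : PullStalk m E)) : s = 0 := by
  have e := Module.finBasisOfFinrankEq ℂ[X] E.Sec E.rank_eq
  refine e.repr.injective (Finsupp.ext fun i => polyCover_injective m ?_)
  have h := pullBasis_repr_tmul m e 1 ((1 : Mer) ⊗ₜ[ℂ[X]] s) i
  rw [hs, Algebra.TensorProduct.basis_repr_tmul, one_mul, one_smul, Finsupp.mapRange_apply] at h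
  rw [map_zero, Finsupp.zero_apply] at h ⊢
  refine h.symm.trans ?_
  simp [polyCover]

/-! ### Consequences of the condition at infinity -/

/-- A simple pole in `l dz - d𝔞` is negligible against the pole of order `2(N+K)+1` of `d𝔞`.
Dividing by `dz/du` leaves the leading term `κ u^{-2N}`. -/
theorem exists_eigenvalue_leading_term {K N : ℕ} [NeZero K] {l : Mer} {κ : ℂ} (hκ : κ ≠ 0)
    (h : PoleLE (l * (const (-2 * K) * coord ^ (-(2 * K + 1) : ℤ)) -
      const (-2 * K * κ) * coord ^ (-(2 * (N + K) + 1) : ℤ)) 1) :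
    ∃ w ∈ oneUnits, l = const κ * (coord ^ (-(2 * N) : ℤ) * w) := by
  have hK : (-2 * K : ℂ) ≠ 0 := by simp [NeZero.ne K]
  set x := coord with hx
  have hx0 : x ≠ 0 := coord_ne_zero
  rw [PoleLE, Int.floor_one, zpow_one] at h
  refine ⟨const κ⁻¹ * (x ^ (2 * N : ℤ) * l), ?_, ?_⟩
  -- With `ε` the difference bounded by `h`, one has `κ⁻¹ u^{2N} l = 1 + (-2Kκ)⁻¹ u^{2K+2N+1} ε`.
  -- One factor `u` makes `ε` holomorphic, a second one is the factor required of a one-unit, and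
  -- the remaining exponent is nonnegative as `K ≥ 1`.
  · refine mem_oneUnits.2 ⟨const ((-2 * K * κ)⁻¹) * (x ^ (2 * K + 2 * N - 1 : ℤ) * _),
      Hol.mul_mem (const_mem_hol _) (Hol.mul_mem (coord_zpow_mem ?_) h), ?_⟩
    · have : 0 < K := NeZero.pos K
      lia
    · have h1 : x * x ^ (2 * K + 2 * N - 1 : ℤ) * x = x ^ (2 * K + 2 * N + 1 : ℤ) := by
        rw [← zpow_one_add₀ hx0, ← zpow_add_one₀ hx0]
        congr 1
        ring
      have h2 : x ^ (2 * K + 2 * N + 1 : ℤ) * x ^ (-(2 * K + 1) : ℤ) = x ^ (2 * N : ℤ) := by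
        rw [← zpow_add₀ hx0]
        congr 1
        ring
      have h3 : x ^ (2 * K + 2 * N + 1 : ℤ) * x ^ (-(2 * (N + K) + 1) : ℤ) = 1 := by
        rw [← zpow_add₀ hx0, ← zpow_zero x]
        congr 1
        ring
      have h4 : const ((-2 * K * κ)⁻¹) * const (-2 * K) = const κ⁻¹ := by
        rw [← map_mul]
        congr 1
        rw [mul_inv, mul_right_comm, inv_mul_cancel₀ hK, one_mul]
      have h5 : const ((-2 * K * κ)⁻¹) * const (-2 * K * κ) = 1 := by
        rw [← map_mul, inv_mul_cancel₀ (mul_ne_zero hK hκ), map_one]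
      rw [← h4, ← h2]
      linear_combination (const ((-2 * K * κ)⁻¹) * const (-2 * K * κ) *
        x ^ (-(2 * (N + K) + 1) : ℤ) - const ((-2 * K * κ)⁻¹) * const (-2 * K) *
        x ^ (-(2 * K + 1) : ℤ) * l) * h1 + const ((-2 * K * κ)⁻¹) * const (-2 * K * κ) * h3 + h5
  · rw [mul_left_comm (x ^ _), ← mul_assoc (x ^ _), ← zpow_add₀ hx0, neg_add_cancel, zpow_zero,
      one_mul, ← mul_assoc, ← map_mul, mul_inv_cancel₀ hκ, map_one, one_mul]

/-- The leading coefficients of the eigenvalues of the Higgs field at infinity. -/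
noncomputable def rootOfIndex (K r : ℕ) : ℂ := Complex.exp (2 * Real.pi * Complex.I * r / K)

theorem rootOfIndex_ne_zero (K r : ℕ) : rootOfIndex K r ≠ 0 := Complex.exp_ne_zero _

theorem rootOfIndex_pow (K r : ℕ) [NeZero K] : rootOfIndex K r ^ K = 1 := by
  rw [rootOfIndex, ← Complex.exp_nat_mul, Complex.exp_eq_one_iff]
  refine ⟨r, ?_⟩
  have : (K : ℂ) ≠ 0 := Nat.cast_ne_zero.2 (NeZero.ne K)
  field_simp
  push_cast
  ring

/-- A germ in the coordinate of the cover. -/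
noncomputable def toCover (m : ℕ) : Mer ≃+* Cover m := RingEquiv.refl Mer

theorem poleLE_toCover_mul (m : ℕ) (p : Mer) (x : Cover m) (β : ℝ) :
    PoleLE (toCover m p * x) β ↔ PoleLE (p * (toCover m).symm x) β := Iff.rfl

theorem polyCover_eq (m : ℕ) [NeZero m] (p : ℂ[X]) :
    polyCover m p = toCover m (powPull m (algebraMap ℂ[X] Mer p)) := rfl

/-- Near `∞` the pulled back Higgs field is diagonalised by a basis splitting the filtration, with
eigenvalues asymptotic to `exp (2πi r / K) z ^ (N / K)`. -/
theorem IsGoodAtInfinity.exists_eigenbasis {K N : ℕ} [NeZero K] {E : FilteredHiggs K}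
    (h : IsGoodAtInfinity K N E) :
    ∃ (f : Module.Basis (Fin K) (Cover (2 * K)) (PullStalk (2 * K) E.toFilteredBundle))
      (lam : Fin K → Cover (2 * K)) (w : Fin K → Mer), (∀ r, w r ∈ oneUnits) ∧
      (∀ r : Fin K, lam r = toCover (2 * K)
        (const (rootOfIndex K (r + 1)) * (coord ^ (-(2 * N) : ℤ) * w r))) ∧
      (∀ β v, v ∈ pullFilt (2 * K) E.toFilteredBundle β ↔ ∀ r, PoleLE (f.repr v r) β) ∧
      ∀ r, pullPhi (2 * K) E (f r) = lam r • f r := by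
  obtain ⟨f, lam, hf, hphi, hlam⟩ := h
  have key : ∀ r : Fin K, ∃ w ∈ oneUnits, (toCover (2 * K)).symm (lam r) =
      const (rootOfIndex K (r + 1)) * (coord ^ (-(2 * N) : ℤ) * w) := fun r =>
    exists_eigenvalue_leading_term (rootOfIndex_ne_zero K (r + 1)) (hlam r)
  choose w hw hlw using key
  exact ⟨f, lam, w, hw, fun r => (RingEquiv.symm_apply_eq _).1 (hlw r), hf, hphi⟩

theorem IsGoodAtInfinity.repr_pullPhi {K : ℕ} [NeZero K] {E : FilteredHiggs K}
    {f : Module.Basis (Fin K) (Cover (2 * K)) (PullStalk (2 * K) E.toFilteredBundle)}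
    {lam : Fin K → Cover (2 * K)} (hphi : ∀ r, pullPhi (2 * K) E (f r) = lam r • f r)
    (v : PullStalk (2 * K) E.toFilteredBundle) (r : Fin K) :
    f.repr (pullPhi (2 * K) E v) r = lam r * f.repr v r := by
  conv_lhs => rw [← f.sum_repr v]
  rw [map_sum, map_sum, Finset.sum_apply', Finset.sum_eq_single r]
  · rw [map_smul, hphi, map_smul, map_smul, Module.Basis.repr_self]
    simp [mul_comm]
  · intro j _ hj
    rw [map_smul, hphi, map_smul, map_smul, Module.Basis.repr_self]
    simp [hj]
  · simp

/-- In the eigenbasis the filtration is the pole order of each coordinate, and `φ` multiplies each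
coordinate by `u^{-2N}` times a unit. -/
theorem IsGoodAtInfinity.pullPhi_mem_iff {K N : ℕ} [NeZero K] {E : FilteredHiggs K}
    (h : IsGoodAtInfinity K N E) (β : ℝ) (v : PullStalk (2 * K) E.toFilteredBundle) :
    pullPhi (2 * K) E v ∈ pullFilt (2 * K) E.toFilteredBundle (β + 2 * N) ↔
      v ∈ pullFilt (2 * K) E.toFilteredBundle β := by
  obtain ⟨f, lam, w, hw, hlam, hf, hphi⟩ := h.exists_eigenbasis
  rw [hf, hf]
  refine forall_congr' fun r => ?_
  obtain ⟨h1, h2, h3⟩ := oneUnits_spec (hw r)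
  rw [repr_pullPhi hphi, hlam, poleLE_toCover_mul, mul_assoc,
    poleLE_const_mul (rootOfIndex_ne_zero _ _), mul_assoc, poleLE_zpow_mul,
    poleLE_unit_mul h1 h2 h3]
  push_cast
  rw [add_neg_cancel_right]
  rfl

theorem eigenvalue_ne_zero {N m : ℕ} {κ : ℂ} (hκ : κ ≠ 0) {w : Mer} (hw : w ∈ oneUnits) :
    toCover m (const κ * (coord ^ (-(2 * N) : ℤ) * w)) ≠ 0 := by
  rw [EmbeddingLike.map_ne_zero_iff]
  exact mul_ne_zero ((_root_.map_ne_zero const).2 hκ)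
    (mul_ne_zero (zpow_ne_zero _ coord_ne_zero) (oneUnits_spec hw).2.2)

/-- All eigenvalues near `∞` are nonzero, and a section is determined by its germ there. -/
theorem IsGoodAtInfinity.phi_injective {K N : ℕ} [NeZero K] {E : FilteredHiggs K}
    (h : IsGoodAtInfinity K N E) : Function.Injective E.phi := by
  obtain ⟨f, lam, w, hw, hlam, -, hphi⟩ := h.exists_eigenbasis
  rw [injective_iff_map_eq_zero]
  intro s hs
  refine eq_zero_of_pull_tmul_eq_zero (2 * K) E.toFilteredBundle
    (f.repr.injective (Finsupp.ext fun r => ?_))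
  have h1 := repr_pullPhi hphi ((1 : Cover (2 * K)) ⊗ₜ[Mer] ((1 : Mer) ⊗ₜ[ℂ[X]] s)) r
  rw [pullPhi_tmul, hs, TensorProduct.tmul_zero, TensorProduct.tmul_zero, map_zero,
    Finsupp.zero_apply] at h1
  rw [map_zero, Finsupp.zero_apply]
  refine (mul_eq_zero.1 h1.symm).resolve_left ?_
  rw [hlam]
  exact eigenvalue_ne_zero (rootOfIndex_ne_zero _ _) (hw r)

/-- The Higgs field raises the order at infinity by exactly `N / K`. -/
theorem IsGoodAtInfinity.sub_eq {K N : ℕ} [NeZero K] {E : FilteredHiggs K}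
    (h : IsGoodAtInfinity K N E) {e : Module.Basis (Fin K) ℂ[X] E.Sec} {a : Fin K → ℝ}
    (he : IsAdapted E.toFilteredBundle e a) {i j : Fin K} {c : ℂ} (hc : c ≠ 0) {n : ℕ}
    (hphi : E.phi (e j) = (C c * X ^ n) • e i) : a i - a j = n - (N : ℝ) / K := by
  have hK : (0 : ℝ) < K := by exact_mod_cast NeZero.pos K
  have key : ∀ (i : Fin K) (p : Mer) (β : ℝ),
      (toCover (2 * K) p • pullBasis (2 * K) e i ∈ pullFilt (2 * K) E.toFilteredBundle β ↔
        PoleLE p (2 * K * a i + β)) := fun i p β => by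
    rw [mem_pullFilt_iff _ he]
    have h1 : ∀ l, (pullBasis (2 * K) e).repr (toCover (2 * K) p • pullBasis (2 * K) e i) l =
        if i = l then toCover (2 * K) p else 0 := fun l => by
      rw [map_smul, Module.Basis.repr_self, Finsupp.smul_apply, Finsupp.single_apply, smul_eq_mul,
        mul_ite, mul_one, mul_zero]
    push_cast
    refine ⟨fun h => ?_, fun h l => ?_⟩
    · have h2 := h i
      rwa [h1, if_pos rfl] at h2
    · rw [h1]
      split_ifs with hl
      · subst hl
        exact h
      · exact PoleLE.zero _
  -- The orders of `e_j` and `φ e_j` on the cover are compared through the steps `β` that contain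
  -- them; taking `β` at the two thresholds gives both inequalities.
  have h1 : ∀ β : ℝ, 0 ≤ 2 * K * a i + (β + 2 * N) + -(2 * K * n) ↔ 0 ≤ 2 * K * a j + β := fun β => by
    have h2 := h.pullPhi_mem_iff β (pullBasis (2 * K) e j)
    have h3 : pullPhi (2 * K) E (pullBasis (2 * K) e j) =
        toCover (2 * K) (const c * coord ^ ((2 * K : ℕ) * (-n : ℤ))) •
          pullBasis (2 * K) e i := by
      rw [pullBasis_apply, pullPhi_tmul, hphi, polyCover_smul, ← pullBasis_apply]
      rw [polyCover_eq, map_mul, map_mul, algebraMap_C, powPull_const, algebraMap_X_pow, powPull_zpow_coord]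
    have h4 : pullBasis (2 * K) e j = toCover (2 * K) 1 • pullBasis (2 * K) e j := by
      rw [map_one, one_smul]
    rw [h3, key, poleLE_const_mul hc, poleLE_zpow, h4, key, poleLE_one] at h2
    rw [← h2]
    push_cast
    rw [mul_neg]
  have h2 := (h1 (-(2 * K * a j))).2 (by simp)
  have h3 := (h1 (-(2 * K * a i + 2 * N + -(2 * K * n)))).1 (by linarith)
  have h4 : K * (a i - a j) = K * n - N := by linarith
  field_simp
  linarith

/-- The `K`-th power of any one eigenvalue is `p`. The root of unity in its leading coefficient
disappears in that power, leaving leading term `u^{-2NK} = z^N`. -/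
theorem IsGoodAtInfinity.monic_of_phi_pow {K N : ℕ} [NeZero K] {E : FilteredHiggs K}
    (h : IsGoodAtInfinity K N E) {p : ℂ[X]} (hp : ∀ s, (E.phi ^ K) s = p • s) :
    p.Monic ∧ p.natDegree = N := by
  obtain ⟨f, lam, w, hw, hlam, -, hphi⟩ := h.exists_eigenbasis
  set r : Fin K := 0
  have h1 : ∀ k : ℕ, (pullPhi (2 * K) E ^ k) (f r) = lam r ^ k • f r := fun k => by
    induction k with
    | zero => simp
    | succ k ih =>
      rw [pow_succ', Module.End.mul_apply, ih, map_smul, hphi, smul_smul, pow_succ]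
  have h2 : ∀ v, (pullPhi (2 * K) E ^ K) v = polyCover (2 * K) p • v := fun v => by
    have e := Module.finBasisOfFinrankEq ℂ[X] E.Sec E.rank_eq
    have h3 : ∀ (k : ℕ) s, (pullPhi (2 * K) E ^ k) ((1 : Cover (2 * K)) ⊗ₜ[Mer]
        ((1 : Mer) ⊗ₜ[ℂ[X]] s)) = (1 : Cover (2 * K)) ⊗ₜ[Mer] ((1 : Mer) ⊗ₜ[ℂ[X]] (E.phi ^ k) s) :=
      fun k s => by
        induction k with
        | zero => rfl
        | succ k ih =>
          rw [pow_succ', Module.End.mul_apply, ih, pullPhi_tmul, pow_succ', Module.End.mul_apply]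
    have h4 : pullPhi (2 * K) E ^ K = LinearMap.lsmul (Cover (2 * K)) _ (polyCover (2 * K) p) := by
      refine (pullBasis (2 * K) e).ext fun i => ?_
      rw [pullBasis_apply, h3, hp, polyCover_smul]
      rfl
    rw [h4]
    rfl
  have h3 : lam r ^ K = polyCover (2 * K) p := by
    have h4 := h1 K
    rw [h2] at h4
    have h5 := congrArg (fun v => f.repr v r) h4
    simpa using h5.symm
  have h4 : lam r ^ K =
      toCover (2 * K) (const 1 * (coord ^ (-(2 * N * K) : ℤ) * w r ^ K)) := by
    rw [hlam, ← map_pow, mul_pow, ← map_pow, rootOfIndex_pow, mul_pow,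
      ← zpow_natCast (coord ^ (-(2 * N) : ℤ)), ← zpow_mul, neg_mul]
  have hp0 : p ≠ 0 := by
    rintro rfl
    have h5 : polyCover (2 * K) 0 = 0 := by simp [polyCover]
    rw [h5] at h3
    refine pow_ne_zero K ?_ h3
    rw [hlam]
    exact eigenvalue_ne_zero (rootOfIndex_ne_zero _ _) (hw r)
  obtain ⟨v, hv, hpv⟩ := polyCover_leading_term (2 * K) hp0
  obtain ⟨h5, h6⟩ := leading_term_unique one_ne_zero (leadingCoeff_ne_zero.2 hp0)
    (pow_mem (hw r) K) hv (h4.symm.trans (h3.trans hpv))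
  refine ⟨h6.symm, ?_⟩
  have hK : (2 * K : ℤ) ≠ 0 := by
    have := NeZero.pos K
    lia
  have h7 : (2 * K : ℤ) * p.natDegree = 2 * K * N := by
    push_cast at h5
    linarith
  exact_mod_cast mul_left_cancel₀ hK h7

/-! ### The bundles attached to cyclic partitions are objects of the category -/

theorem rootOfIndex_eq_pow (K r : ℕ) [NeZero K] :
    rootOfIndex K r = Complex.exp (2 * Real.pi * Complex.I / K) ^ r := by
  rw [rootOfIndex, ← Complex.exp_nat_mul]
  congr 1
  ring

theorem rootOfIndex_succ_injective (K : ℕ) [NeZero K] :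
    Function.Injective fun r : Fin K => rootOfIndex K (r + 1) := by
  intro r s h
  simp only [rootOfIndex_eq_pow, pow_succ] at h
  have h1 := Complex.isPrimitiveRoot_exp K (NeZero.ne K)
  exact Fin.ext (h1.pow_inj r.2 s.2 (mul_right_cancel₀ (Complex.exp_ne_zero _) h))

theorem rootOfIndex_pow_finRotate (K r : ℕ) [NeZero K] (i : Fin K) :
    rootOfIndex K r ^ (finRotate K i : ℕ) = rootOfIndex K r * rootOfIndex K r ^ (i : ℕ) := by
  obtain ⟨n, rfl⟩ : ∃ n, K = n + 1 := ⟨K - 1, by have := i.2; lia⟩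
  have h := val_finRotate_pow 1 i
  rw [pow_one] at h
  rw [h, ← pow_eq_pow_mod _ (rootOfIndex_pow (n + 1) r), pow_succ']

/-- The change of basis by an invertible matrix of constants does not change pole orders. -/
theorem exists_basis_of_isUnit_det {m K : ℕ} {V : Type*} [AddCommGroup V] [Module (Cover m) V]
    (g : Module.Basis (Fin K) (Cover m) V) {A : Matrix (Fin K) (Fin K) ℂ} (hA : IsUnit A.det) :
    ∃ f : Module.Basis (Fin K) (Cover m) V,
      (∀ r, f r = ∑ i, toCover m (const (A i r)) • g i) ∧
      ∀ (v : V) (β : ℝ), (∀ i, PoleLE (g.repr v i) β) ↔ ∀ r, PoleLE (f.repr v r) β := by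
  set φ : ℂ →+* Cover m := (toCover m).toRingHom.comp const with hφ
  have h1 : (A.map φ) * (A⁻¹.map φ) = 1 := by
    rw [← Matrix.map_mul, Matrix.mul_nonsing_inv _ hA, Matrix.map_one _ (map_zero φ) (map_one φ)]
  have h2 : (A⁻¹.map φ) * (A.map φ) = 1 := by
    rw [← Matrix.map_mul, Matrix.nonsing_inv_mul _ hA, Matrix.map_one _ (map_zero φ) (map_one φ)]
  set L := Matrix.toLin'OfInv h2 h1 with hL
  set f := Module.Basis.ofEquivFun (g.equivFun ≪≫ₗ L.symm) with hf
  have hfg : ∀ v, g.equivFun v = (A.map φ).mulVec (f.equivFun v) := fun v => by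
    have : L (f.equivFun v) = g.equivFun v := by
      rw [hf, Module.Basis.equivFun_ofEquivFun, LinearEquiv.trans_apply, LinearEquiv.apply_symm_apply]
    rw [← this]
    rfl
  have hgf : ∀ v, f.equivFun v = (A⁻¹.map φ).mulVec (g.equivFun v) := fun v => by
    rw [hfg, Matrix.mulVec_mulVec, h2, Matrix.one_mulVec]
  have hmul : ∀ (B : Matrix (Fin K) (Fin K) ℂ) (x : Fin K → Cover m) (β : ℝ),
      (∀ i, PoleLE (x i) β) → ∀ i, PoleLE ((B.map φ).mulVec x i) β := fun B x β hx i =>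
    PoleLE.sum (a := fun j => const (B i j) * (toCover m).symm (x j)) fun j _ =>
      PoleLE.hol_mul (const_mem_hol _) (hx j)
  refine ⟨f, fun r => ?_, fun v β => ⟨fun h => ?_, fun h => ?_⟩⟩
  · rw [← g.sum_equivFun (f r), hfg]
    refine Finset.sum_congr rfl fun i _ => ?_
    have : f.equivFun (f r) = Pi.single r 1 := by
      ext1 j
      rw [Module.Basis.equivFun_self]
      simp [Pi.single_apply, eq_comm]
    rw [this, Matrix.mulVec_single_one]
    rfl
  · have := hmul A⁻¹ (g.equivFun v) β h
    rw [← hgf] at this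
    exact this
  · have := hmul A (f.equivFun v) β h
    rw [← hfg] at this
    exact this

/-- The coefficients in `parDeg` have denominator `2K`, so on the cover of degree `2K` the weights
are integers and can be absorbed by powers of `u`. -/
theorem exists_int_parDeg {K N : ℕ} (b : OrderedPartition K N) (i : Fin K) :
    ∃ n : ℤ, (n : ℝ) = (2 * K : ℕ) * parDeg b i := by
  have hK : (K : ℝ) ≠ 0 := Nat.cast_ne_zero.2 (by have := i.2; lia)
  refine ⟨∑ j, ((K - 1 : ℤ) - 2 * ((j - i : Fin K) : ℕ)) * b.1 j, ?_⟩
  rw [parDeg, Finset.mul_sum]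
  push_cast
  refine Finset.sum_congr rfl fun j _ => ?_
  field_simp

theorem isGoodAtInfinity_higgsOf {K N : ℕ} [NeZero K] (b : OrderedPartition K N) :
    IsGoodAtInfinity K N (higgsOf b) := by
  choose n hn using exists_int_parDeg b
  set e : Module.Basis (Fin K) ℂ[X] (higgsOf b).Sec := Pi.basisFun ℂ[X] (Fin K)
  have he : IsAdapted (higgsOf b).toFilteredBundle e (parDeg b) := sumO_isAdapted _
  set U := pullBasis (2 * K) e with hU
  -- The sections `u^{-n_i} e_i`, with `n_i = 2K α_i`, have order `0` and trivialise the filtration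
  -- on the cover.
  have hu : ∀ i, IsUnit (toCover (2 * K) (coord ^ (-n i))) := fun i =>
    ((EmbeddingLike.map_ne_zero_iff).2 (zpow_ne_zero _ coord_ne_zero)).isUnit
  set g := U.isUnitSMul hu with hg
  have hgU : ∀ i, g i = toCover (2 * K) (coord ^ (-n i)) • U i := U.isUnitSMul_apply hu
  have hrepr : ∀ v i, U.repr v i = toCover (2 * K) (coord ^ (-n i)) * g.repr v i := fun v i => by
    rw [hg, Module.Basis.repr_isUnitSMul, Units.smul_def, smul_eq_mul, ← mul_assoc,
      IsUnit.mul_val_inv, one_mul]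
  have hstep : ∀ i, n i - n (finRotate K i) = 2 * K * b.1 i - 2 * N := fun i => by
    have hK : (K : ℝ) ≠ 0 := Nat.cast_ne_zero.2 (NeZero.ne K)
    have h1 := parDeg_sub b i
    have h2 : (n i : ℝ) - n (finRotate K i) = 2 * K * b.1 i - 2 * N := by
      rw [hn, hn, ← mul_sub, h1]
      push_cast
      field_simp
    exact_mod_cast h2
  -- In the rescaled basis every arrow carries the same factor: `-n_{i+1} - 2K b_i = -2N - n_i`.
  -- Thus `φ` is `u^{-2N}` times a cyclic shift.
  have hphi : ∀ i, pullPhi (2 * K) (higgsOf b) (g (finRotate K i)) =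
      toCover (2 * K) (coord ^ (-(2 * N) : ℤ)) • g i := fun i => by
    have h1 := higgsOf_phi_basisFun b i
    rw [hgU, hgU, map_smul, hU, pullBasis_apply, pullPhi_tmul]
    refine (congrArg (fun s => toCover (2 * K) (coord ^ (-n (finRotate K i))) •
      ((1 : Cover (2 * K)) ⊗ₜ[Mer] ((1 : Mer) ⊗ₜ[ℂ[X]] s))) h1).trans ?_
    refine (congrArg (fun s => toCover (2 * K) (coord ^ (-n (finRotate K i))) • s)
      (polyCover_smul (2 * K) (E := (higgsOf b).toFilteredBundle) (X ^ b.1 i) (e i))).trans ?_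
    rw [← pullBasis_apply, smul_smul, smul_smul, polyCover_eq, algebraMap_X_pow,
      powPull_zpow_coord, ← map_mul, ← map_mul, ← zpow_add₀ coord_ne_zero,
      ← zpow_add₀ coord_ne_zero]
    congr 3
    have := hstep i
    push_cast
    linarith
  -- Column `r` is `(ω_r^i)_i` with `ω_r = exp(2πi(r+1)/K)`, an eigenvector of the cyclic shift. The
  -- index is shifted because `Fin K` starts at `0` and the singular types at `r = 1`.
  set A : Matrix (Fin K) (Fin K) ℂ :=
    (Matrix.vandermonde fun r : Fin K => rootOfIndex K (r + 1)).transpose with hA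
  have hdet : IsUnit A.det := by
    rw [hA, Matrix.det_transpose]
    exact (Matrix.det_vandermonde_ne_zero_iff.2 (rootOfIndex_succ_injective K)).isUnit
  obtain ⟨f, hf, hfilt⟩ := exists_basis_of_isUnit_det g hdet
  refine ⟨f, fun r => toCover (2 * K) (const (rootOfIndex K (r + 1)) * coord ^ (-(2 * N) : ℤ)),
    fun β v => ?_, fun r => ?_, fun r => ?_⟩
  · rw [← hfilt, mem_pullFilt_iff _ he]
    refine forall_congr' fun i => ?_
    rw [← hU, hrepr, poleLE_toCover_mul, poleLE_zpow_mul, Int.cast_neg, hn, add_neg_cancel_comm]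
    rfl
  · rw [hf, map_sum, Finset.smul_sum, ← Equiv.sum_comp (finRotate K)]
    refine Finset.sum_congr rfl fun i _ => ?_
    rw [map_smul, hphi, smul_smul, smul_smul, ← map_mul, ← map_mul]
    congr 2
    rw [hA, Matrix.transpose_apply, Matrix.transpose_apply, Matrix.vandermonde_apply,
      Matrix.vandermonde_apply, rootOfIndex_pow_finRotate, map_mul]
    ring
  -- For `φ_b` the difference with the singular type is not merely logarithmic: it vanishes.
  · have h1 : const (rootOfIndex K (r + 1)) * coord ^ (-(2 * N) : ℤ) *
        (const (-2 * K) * coord ^ (-(2 * K + 1) : ℤ)) -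
        const (-2 * K * rootOfIndex K (r + 1)) * coord ^ (-(2 * (N + K) + 1) : ℤ) = 0 := by
      have h2 : (-(2 * (N + K) + 1) : ℤ) = -(2 * N) + -(2 * K + 1) := by ring
      rw [h2, zpow_add₀ coord_ne_zero, map_mul const (-2 * K : ℂ)]
      ring
    have h3 := PoleLE.zero 1
    rw [← h1] at h3
    exact h3

/-- The object `(ℰ_b, φ_b)`. -/
noncomputable def objectOf {K N : ℕ} [NeZero K] (hK : 2 ≤ K) (b : OrderedPartition K N) :
    CObject K N where
  toFilteredHiggs := higgsOf b
  sl := slStructureSumO (sum_parDeg b)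
  traceless := by
    change LinearMap.trace ℂ[X] (Fin K → ℂ[X]) (Matrix.toLin' (cyclicMatrix b)) = 0
    rw [Matrix.trace_toLin'_eq, Matrix.trace]
    refine Finset.sum_eq_zero fun i _ => ?_
    have : i ≠ finRotate K i := by
      obtain ⟨n, rfl⟩ : ∃ n, K = n + 2 := ⟨K - 2, by lia⟩
      rw [finRotate_apply]
      simp
    simp only [cyclicMatrix, Matrix.diag_apply, Matrix.of_apply, if_neg this]
  good := isGoodAtInfinity_higgsOf b

theorem higgsOf_mem_fixedPoints {K N : ℕ} [NeZero K] (hK : 2 ≤ K) (b : OrderedPartition K N) :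
    (⟦higgsOf b⟧ : HiggsClass K) ∈ fixedPoints K N :=
  ⟨⟨objectOf hK b, rfl⟩, fun t => Quotient.sound (higgsIso_act_higgsOf (by lia) t b)⟩

/-! ### Automorphisms with constant eigenvalues -/

/-- A free module of rank `K` over a principal ideal domain which is the direct sum of `K` nonzero
submodules has a basis adapted to the decomposition. -/
theorem exists_basis_of_isInternal {K : ℕ} {R M : Type*} [CommRing R] [IsDomain R]
    [IsPrincipalIdealRing R] [AddCommGroup M] [Module R M] [Module.Finite R M] [Module.Free R M]
    (hM : Module.finrank R M = K) {A : Fin K → Submodule R M} (hA : DirectSum.IsInternal A)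
    (hne : ∀ j, A j ≠ ⊥) : ∃ e : Module.Basis (Fin K) R M, ∀ j, e j ∈ A j := by
  have hpos : ∀ j, 1 ≤ Module.finrank R (A j) := fun j => by
    have : Nontrivial (A j) := Submodule.nontrivial_iff_ne_bot.2 (hne j)
    exact Module.finrank_pos
  -- The ranks are at least `1` and add up to `K`, so each summand has rank one.
  have hsum : ∑ j, Module.finrank R (A j) = ∑ j : Fin K, 1 := by
    have h1 := Module.finrank_eq_card_basis (hA.collectedBasis fun j => Module.finBasis R (A j))
    rw [hM, Fintype.card_sigma] at h1
    simp only [Fintype.card_fin] at h1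
    rw [← h1]
    simp
  have hone : ∀ j, Module.finrank R (A j) = 1 := fun j =>
    ((Finset.sum_eq_sum_iff_of_le fun j _ => hpos j).1 hsum.symm j (Finset.mem_univ j)).symm
  have e : ∀ j, Module.Basis Unit R (A j) := fun j => Module.basisUnique Unit (hone j)
  refine ⟨(hA.collectedBasis e).reindex (Equiv.sigmaUnique (Fin K) fun _ => Unit), fun j => ?_⟩
  rw [Module.Basis.reindex_apply]
  exact hA.collectedBasis_mem e ⟨j, default⟩

/-- An endomorphism of a free `ℂ[X]`-module of rank `K` with `K` distinct constant eigenvalues has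
an eigenbasis. -/
theorem exists_eigenbasis_of_hasEigenvalue {K : ℕ} [NeZero K] {M : Type} [AddCommGroup M]
    [Module ℂ[X] M] [Module.Finite ℂ[X] M] [Module.Free ℂ[X] M]
    (hM : Module.finrank ℂ[X] M = K) {g : Module.End ℂ[X] M} {m : Fin K → ℂ}
    (hm : Function.Injective m) (hg : ∀ j, g.HasEigenvalue (C (m j))) :
    ∃ e : Module.Basis (Fin K) ℂ[X] M, ∀ j, g (e j) = C (m j) • e j := by
  have hCm : Function.Injective fun j => (C (m j) : ℂ[X]) := C_injective.comp hm
  have hmonic : (∏ j, (X - C (C (m j))) : ℂ[X][X]).Monic :=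
    monic_prod_of_monic _ _ fun j _ => monic_X_sub_C _
  have hdvd : (∏ j, (X - C (C (m j))) : ℂ[X][X]) ∣ LinearMap.charpoly g := by
    refine Finset.prod_dvd_of_coprime (fun i _ j _ hij => ?_) fun j _ =>
      dvd_iff_isRoot.2 ((Module.End.hasEigenvalue_iff_isRoot_charpoly g _).1 (hg j))
    -- Over `ℂ[X]` distinct eigenvalues would not be enough: constancy makes their differences
    -- units, so the linear factors are coprime and the projections below have no denominators.
    have hu : IsUnit (C (m i) - C (m j) : ℂ[X]) := by
      rw [← C_sub, isUnit_C]
      exact (sub_ne_zero.2 fun h => hij (hm h)).isUnit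
    exact isCoprime_X_sub_C_of_isUnit_sub hu
  have hdeg : (LinearMap.charpoly g).natDegree ≤ (∏ j, (X - C (C (m j))) : ℂ[X][X]).natDegree := by
    rw [LinearMap.charpoly_natDegree, hM, natDegree_prod_of_monic _ _ fun j _ => monic_X_sub_C _]
    simp
  have hchar : LinearMap.charpoly g = ∏ j, (X - C (C (m j))) :=
    eq_of_monic_of_dvd_of_natDegree_le hmonic (LinearMap.charpoly_monic g) hdvd hdeg
  -- Multiplying the Lagrange polynomial of `m j` by `X - m j` gives a constant multiple of the
  -- characteristic polynomial, so Cayley–Hamilton puts its value at `g` into the eigenspace. These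
  -- polynomials sum to `1`, hence the eigenspaces span.
  have hker : ∀ j (v : M), aeval g ((Lagrange.basis Finset.univ m j).map C) v ∈
      g.eigenspace (C (m j)) := fun j v => by
    have h1 : ((X - C (m j)) * Lagrange.basis Finset.univ m j).map C =
        C (C (∏ i ∈ Finset.univ.erase j, (m j - m i)⁻¹)) * LinearMap.charpoly g := by
      rw [hchar, Lagrange.basis]
      simp only [Lagrange.basisDivisor]
      rw [Finset.prod_mul_distrib, mul_left_comm, ← map_prod,
        Finset.mul_prod_erase Finset.univ (fun i => X - C (m i)) (Finset.mem_univ j),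
        Polynomial.map_mul, Polynomial.map_prod]
      simp
    have h2 := congrArg (fun q => aeval g q v) h1
    simp only [map_mul (aeval g), LinearMap.aeval_self_charpoly, mul_zero, Polynomial.map_mul,
      Module.End.mul_apply, LinearMap.zero_apply] at h2
    rw [Module.End.mem_eigenspace_iff, ← sub_eq_zero, ← h2]
    simp
  have hint : DirectSum.IsInternal fun j => g.eigenspace (C (m j)) := by
    refine DirectSum.isInternal_submodule_of_iSupIndep_of_iSup_eq_top
      (g.eigenspaces_iSupIndep.comp hCm) (eq_top_iff.2 fun v _ => ?_)
    have h1 : v = ∑ j, aeval g ((Lagrange.basis Finset.univ m j).map C) v := by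
      rw [← LinearMap.sum_apply, ← map_sum, ← Polynomial.map_sum,
        Lagrange.sum_basis hm.injOn Finset.univ_nonempty]
      simp
    rw [h1]
    exact Submodule.sum_mem _ fun j _ => Submodule.mem_iSup_of_mem j (hker j v)
  obtain ⟨e, he⟩ := exists_basis_of_isInternal hM hint hg
  exact ⟨e, fun j => Module.End.mem_eigenspace_iff.1 (he j)⟩

/-- The characteristic polynomial of a filtered endomorphism is constant. -/
theorem charpoly_mem_lifts {K : ℕ} {E : FilteredBundle K} (g : Module.End ℂ[X] E.Sec) {α : ℝ}
    (hg : ∀ v ∈ E.filt α, LinearMap.baseChange Mer g v ∈ E.filt α) :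
    LinearMap.charpoly g ∈ lifts (C : ℂ →+* ℂ[X]) := by
  obtain ⟨b, hb⟩ := E.lattice α
  have hrepr : ∀ v ∈ E.filt α, ∀ i, b.repr v i ∈ Hol := by
    intro v hv i
    rw [hb] at hv
    induction hv using Submodule.span_induction with
    | mem v hv =>
      obtain ⟨j, rfl⟩ := hv
      rw [Module.Basis.repr_self, Finsupp.single_apply]
      split_ifs
      exacts [Hol.one_mem, Hol.zero_mem]
    | zero => rw [map_zero]; exact Hol.zero_mem
    | add x y _ _ hx hy => rw [map_add]; exact Hol.add_mem hx hy
    | smul h x _ hx =>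
      rw [hol_smul, map_smul]
      exact Hol.mul_mem h.2 hx
  have hentry : ∀ i j, LinearMap.toMatrix b b (LinearMap.baseChange Mer g) i j ∈ Hol := by
    intro i j
    rw [LinearMap.toMatrix_apply]
    refine hrepr _ (hg _ ?_) i
    rw [hb]
    exact Submodule.subset_span (Set.mem_range_self j)
  set A : Matrix (Fin K) (Fin K) Hol := Matrix.of fun i j => ⟨_, hentry i j⟩
  have hA : A.map Hol.subtype = LinearMap.toMatrix b b (LinearMap.baseChange Mer g) := rfl
  -- The same characteristic polynomial is computed in a basis of the lattice `filt α`, where `g`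
  -- has holomorphic entries. Its coefficients are polynomials that are holomorphic at `∞`.
  have hchar : (LinearMap.charpoly g).map (algebraMap ℂ[X] Mer) = A.charpoly.map Hol.subtype := by
    rw [← LinearMap.charpoly_baseChange, ← LinearMap.charpoly_toMatrix _ b, ← hA,
      Matrix.charpoly_map]
  rw [lifts_iff_coeff_lifts]
  intro k
  have h1 : algebraMap ℂ[X] Mer ((LinearMap.charpoly g).coeff k) ∈ Hol := by
    rw [← coeff_map, hchar, coeff_map]
    exact (A.charpoly.coeff k).2
  exact ⟨_, (algebraMap_mem_hol h1).symm⟩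

/-- A filtered endomorphism of a filtered bundle has a constant eigenvalue. -/
theorem exists_hasEigenvalue {K : ℕ} [NeZero K] {E : FilteredBundle K} (g : Module.End ℂ[X] E.Sec)
    {α : ℝ} (hg : ∀ v ∈ E.filt α, LinearMap.baseChange Mer g v ∈ E.filt α) :
    ∃ μ : ℂ, g.HasEigenvalue (C μ) := by
  obtain ⟨q, hq⟩ := (mem_lifts _).1 (charpoly_mem_lifts g hg)
  have hdeg : q.degree ≠ 0 := by
    rw [← degree_map_eq_of_injective C_injective q, hq, degree_eq_natDegree
      (LinearMap.charpoly_monic g).ne_zero, LinearMap.charpoly_natDegree, E.rank_eq]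
    exact_mod_cast NeZero.ne K
  obtain ⟨μ, hμ⟩ := IsAlgClosed.exists_root q hdeg
  refine ⟨μ, (Module.End.hasEigenvalue_iff_isRoot_charpoly g _).2 ?_⟩
  rw [← hq]
  exact hμ.map

/-- An eigenbasis, with distinct constant eigenvalues, of a filtered endomorphism splits the
filtered bundle. -/
theorem exists_isAdapted_of_eigenbasis {K : ℕ} {E : FilteredBundle K}
    {e : Module.Basis (Fin K) ℂ[X] E.Sec} {g : Module.End ℂ[X] E.Sec} {m : Fin K → ℂ}
    (hm : Function.Injective m) (he : ∀ j, g (e j) = C (m j) • e j)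
    (hg : ∀ α, ∀ v ∈ E.filt α, LinearMap.baseChange Mer g v ∈ E.filt α) :
    ∃ a : Fin K → ℝ, IsAdapted E e a := by
  set B := Algebra.TensorProduct.basis Mer e with hB
  have hsmul : ∀ {α : ℝ} {v : E.Stalk} {h : Mer}, h ∈ Hol → v ∈ E.filt α → h • v ∈ E.filt α :=
    fun {α v h} hh hv => (E.filt α).smul_mem (⟨h, hh⟩ : Hol) hv
  have hrepr : ∀ v i, B.repr (LinearMap.baseChange Mer g v) i = const (m i) * B.repr v i := by
    intro v i
    conv_lhs => rw [← B.sum_repr v]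
    have h1 : ∀ j, LinearMap.baseChange Mer g (B j) = const (m j) • B j := fun j => by
      rw [hB, Algebra.TensorProduct.basis_apply, LinearMap.baseChange_tmul, he,
        TensorProduct.tmul_smul, algebra_compatible_smul Mer (C (m j)), algebraMap_C]
    rw [map_sum, map_sum, Finset.sum_apply', Finset.sum_eq_single i]
    · rw [map_smul, h1, map_smul, map_smul, Module.Basis.repr_self]
      simp [mul_comm]
    · intro j _ hj
      rw [map_smul, h1, map_smul, map_smul, Module.Basis.repr_self]
      simp [hj]
    · simp
  -- The operator `∏ (g - m_l)` over `l ∈ s` preserves each step. For `s` the complement of `j` it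
  -- is a nonzero constant times the projection to line `j`.
  have hfactor : ∀ (α : ℝ) (v : E.Stalk), v ∈ E.filt α → ∀ s : Finset (Fin K), ∃ w ∈ E.filt α,
      ∀ i, B.repr w i = const (∏ l ∈ s, (m i - m l)) * B.repr v i := by
    intro α v hv s
    induction s using Finset.induction_on with
    | empty => exact ⟨v, hv, fun i => by simp⟩
    | insert l s hl ih =>
      obtain ⟨w, hw, hwr⟩ := ih
      refine ⟨LinearMap.baseChange Mer g w - const (m l) • w,
        Submodule.sub_mem _ (hg α w hw) (hsmul (const_mem_hol _) hw), fun i => ?_⟩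
      rw [map_sub, Finsupp.sub_apply, hrepr, map_smul, Finsupp.smul_apply, smul_eq_mul, hwr,
        Finset.prod_insert hl, map_mul, map_sub]
      ring
  have hproj : ∀ (α : ℝ) (v : E.Stalk), v ∈ E.filt α → ∀ j, B.repr v j • B j ∈ E.filt α := by
    intro α v hv j
    obtain ⟨w, hw, hwr⟩ := hfactor α v hv (Finset.univ.erase j)
    set d := ∏ l ∈ Finset.univ.erase j, (m j - m l)
    have hd : d ≠ 0 := Finset.prod_ne_zero_iff.2 fun l hl =>
      sub_ne_zero.2 fun h => (Finset.ne_of_mem_erase hl) (hm h).symm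
    convert hsmul (const_mem_hol d⁻¹) hw using 1
    refine B.repr.injective (Finsupp.ext fun i => ?_)
    rw [map_smul, Finsupp.smul_apply, Module.Basis.repr_self, map_smul, Finsupp.smul_apply, hwr,
      smul_eq_mul, smul_eq_mul]
    by_cases hi : j = i
    · subst hi
      rw [Finsupp.single_eq_same, mul_one, ← mul_assoc, ← map_mul, inv_mul_cancel₀ hd, map_one,
        one_mul]
    · rw [Finsupp.single_eq_of_ne (Ne.symm hi),
        Finset.prod_eq_zero (Finset.mem_erase.2 ⟨Ne.symm hi, Finset.mem_univ i⟩) (sub_self _)]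
      simp
  have hmem : ∀ (α : ℝ) (v : E.Stalk), v ∈ E.filt α ↔ ∀ j, B.repr v j • B j ∈ E.filt α := by
    refine fun α v => ⟨hproj α v, fun h => ?_⟩
    rw [← B.sum_repr v]
    exact Submodule.sum_mem _ fun j _ => h j
  have hline : ∀ j, ∃ a : ℝ, ∀ (α : ℝ) (h : Mer), h • B j ∈ E.filt α ↔ PoleLE h (a + α) := by
    intro j
    -- The filtration induced on the `j`-th line, read as a filtration of the field of germs by its
    -- coefficient along `B j`.
    set P : ℝ → Submodule Hol Mer := fun α =>
      { carrier := {h | h • B j ∈ E.filt α}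
        add_mem' := fun {x y} hx hy => by
          change (x + y) • B j ∈ E.filt α
          rw [add_smul]
          exact Submodule.add_mem _ hx hy
        zero_mem' := by
          change (0 : Mer) • B j ∈ E.filt α
          rw [zero_smul]
          exact Submodule.zero_mem _
        smul_mem' := fun c x hx => by
          change ((c : Mer) * x) • B j ∈ E.filt α
          rw [mul_smul]
          exact hsmul c.2 hx }
    have hP : ∀ α h, h ∈ P α ↔ h • B j ∈ E.filt α := fun _ _ => Iff.rfl
    obtain ⟨b, hb⟩ := E.lattice 0
    refine exists_poleLE_shift P (fun α β hαβ h hh => E.mono hαβ hh) (fun α h hh => ?_)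
      (fun α h => ?_) ?_ ?_
    · rw [hP, E.right_cont α]
      simp only [Submodule.mem_iInf]
      exact hh
    · rw [hP, E.shift]
      constructor
      · rintro ⟨w, hw, hwh⟩
        have h1 : (coord⁻¹ * h) • B j = w := by
          rw [mul_smul, hwh, smul_smul, inv_mul_cancel₀ coord_ne_zero, one_smul]
        refine ⟨coord⁻¹ * h, ?_, (mul_inv_cancel_left₀ coord_ne_zero h).symm⟩
        rw [hP, h1]
        exact hw
      · rintro ⟨w, hw, rfl⟩
        exact ⟨w • B j, hw, mul_smul _ _ _⟩
    -- If the induced step `0` were zero, the `j`-th coordinate would vanish on a lattice basis,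
    -- hence everywhere.
    · by_contra! h0
      have h1 : ∀ v : E.Stalk, B.repr v j = 0 := by
        have h2 : B.coord j = 0 := b.ext fun i => by
          refine h0 _ (hproj 0 _ ?_ j)
          rw [hb]
          exact Submodule.subset_span (Set.mem_range_self i)
        exact fun v => LinearMap.congr_fun h2 v
      have h2 := h1 (B j)
      rw [Module.Basis.repr_self, Finsupp.single_eq_same] at h2
      exact one_ne_zero h2
    · choose n hn using fun i => PoleLE.exists_bound (B.repr (b i) j)
      obtain ⟨n', hn'⟩ := (Set.finite_range n).bddAbove
      have h1 : ∀ v ∈ E.filt 0, PoleLE (B.repr v j) n' := by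
        intro v hv
        rw [hb] at hv
        induction hv using Submodule.span_induction with
        | mem v hv =>
          obtain ⟨i, rfl⟩ := hv
          exact PoleLE.mono (by exact_mod_cast hn' (Set.mem_range_self i)) (hn i)
        | zero => rw [map_zero]; exact PoleLE.zero _
        | add x y _ _ hx hy => rw [map_add]; exact PoleLE.add hx hy
        | smul h x _ hx =>
          rw [hol_smul, map_smul]
          exact PoleLE.hol_mul h.2 hx
      refine ⟨n', fun h hh => ?_⟩
      have h2 := h1 _ hh
      rwa [map_smul, Finsupp.smul_apply, Module.Basis.repr_self, Finsupp.single_eq_same,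
        smul_eq_mul, mul_one] at h2
  choose a ha using hline
  exact ⟨a, fun β v => (hmem β v).trans (forall_congr' fun j => ha j β _)⟩

/-! ### Fixed points -/

/-- An isomorphism `ρ_t^* ℰ ≃ ℰ` which preserves the Higgs fields is a semilinear automorphism of
the sections of `ℰ`. -/
theorem exists_semilinear_of_act {K N : ℕ} {E : FilteredHiggs K} {t : ℂ}
    (h : HiggsIso (E.act N t) E) :
    ∃ T : E.Sec ≃+ E.Sec, (∀ (p : ℂ[X]) s, T (p • s) = polyRot (rotFactor K N t) p • T s) ∧
      ∀ s, E.phi (T s) = C (Complex.exp t * rotFactor K N t) • T (E.phi s) := by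
  obtain ⟨g, -, hphi⟩ := h
  set c := rotFactor K N t with hc
  have hT : ∀ s, ((toRot c E.Sec).trans g.toAddEquiv) s = g (toRot c E.Sec s) := fun s => rfl
  refine ⟨(toRot c E.Sec).trans g.toAddEquiv, fun p s => ?_, fun s => ?_⟩
  · rw [hT, hT]
    exact (congrArg g (toRot_smul c E.Sec p s)).trans (map_smul g _ _)
  · rw [hT, hT]
    exact (hphi (toRot c E.Sec s)).symm.trans (map_smul g _ _)

/-- When `ρ_t = 1`, an isomorphism `ρ_t^* ℰ ≃ ℰ` is a filtered automorphism of `ℰ`. -/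
theorem exists_automorphism_of_act {K N : ℕ} {E : FilteredHiggs K} {t : ℂ}
    (h : HiggsIso (E.act N t) E) (ht : rotFactor K N t = 1) :
    ∃ g : Module.End ℂ[X] E.Sec, Function.Injective g ∧
      (∀ s, E.phi (g s) = C (Complex.exp t) • g (E.phi s)) ∧
      ∀ α, ∀ v ∈ E.filt α, LinearMap.baseChange Mer g v ∈ E.filt α := by
  obtain ⟨g, hfilt, hphi⟩ := h
  set c := rotFactor K N t with hc
  have hlin : ∀ (p : ℂ[X]) s, g (toRot c E.Sec (p • s)) = p • g (toRot c E.Sec s) := fun p s => by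
    have h1 := (congrArg g (toRot_smul c E.Sec p s)).trans (map_smul g _ _)
    rw [ht, polyRot_one, ← ht] at h1
    exact h1
  set T : Module.End ℂ[X] E.Sec :=
    { toFun := fun s => g (toRot c E.Sec s)
      map_add' := fun s s' => map_add g _ _
      map_smul' := hlin } with hT
  refine ⟨T, g.injective.comp (toRot c E.Sec).injective, fun s => ?_, fun α v hv => ?_⟩
  · refine (hphi (toRot c E.Sec s)).symm.trans ((map_smul g _ _).trans ?_)
    rw [← hc, ht, Units.val_one, mul_one]
    rfl
  · have h1 : ∀ v, LinearMap.baseChange Mer T v =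
        LinearMap.baseChange Mer g.toLinearMap (rotStalk c E.Sec v) := by
      intro v
      induction v using TensorProduct.induction_on with
      | zero =>
        rw [map_zero, map_zero]
        exact (map_zero (LinearMap.baseChange Mer g.toLinearMap)).symm
      | tmul f s =>
        have h2 : Mer.rot c⁻¹ f = f := by rw [ht, inv_one, rot_one]
        rw [LinearMap.baseChange_tmul, rotStalk_tmul, h2]
        rfl
      | add x y hx hy =>
        rw [map_add, map_add, hx, hy]
        exact (map_add (LinearMap.baseChange Mer g.toLinearMap) _ _).symm
    rw [h1]
    refine (hfilt α _).1 ((mem_rotSubmodule c E.Sec (E.filt α) _).2 ?_)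
    rwa [AddEquiv.symm_apply_apply]

/-- A polynomial which is semi-invariant under all rotations is a monomial. -/
theorem eq_X_pow_of_semiinvariant {f : ℂ[X]} {N : ℕ} (hf : f.Monic) (hN : f.natDegree = N)
    {c : ℂˣ} (hc : Function.Injective fun n : ℕ => (c : ℂ) ^ n) {κ : ℂ}
    (h : f = C κ * polyRot c f) : f = X ^ N := by
  have hcoeff : ∀ i, f.coeff i = κ * (f.coeff i * (c : ℂ) ^ i) := fun i => by
    conv_lhs => rw [h]
    rw [coeff_C_mul, polyRot, coe_compRingHom_apply, comp_C_mul_X_coeff]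
  have hlead : f.coeff N = 1 := by rw [← hN]; exact hf
  -- Comparing coefficients, `a_i = κ c^i a_i`; the leading one gives `κ c^N = 1`, so any other
  -- nonzero `a_i` would force `c^i = c^N`.
  have h1 := hcoeff N
  rw [hlead, one_mul] at h1
  ext i
  rw [coeff_X_pow]
  split_ifs with hi
  · rw [hi, hlead]
  · by_contra h0
    have h2 : κ * (c : ℂ) ^ i = 1 := mul_left_cancel₀ h0 (by linear_combination -hcoeff i)
    have hκ : κ ≠ 0 := left_ne_zero_of_mul (h1 ▸ one_ne_zero)
    exact hi (hc (mul_left_cancel₀ hκ (h2.trans h1)))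

/-- At `t = 1` the factor is a real number strictly between `0` and `1`. -/
theorem rotFactor_one_pow_injective (K N : ℕ) [NeZero K] :
    Function.Injective fun n : ℕ => (rotFactor K N 1 : ℂ) ^ n := by
  have h1 : (rotFactor K N 1 : ℂ) = (Real.exp (-(K / (K + N))) : ℝ) := by
    rw [rotFactor, Units.val_mk0]
    push_cast
    rw [mul_one]
  have hK : (0 : ℝ) < K := by exact_mod_cast NeZero.pos K
  have h2 : Real.exp (-(K / (K + N) : ℝ)) < 1 := by
    rw [Real.exp_lt_one_iff]
    have : 0 < (K / (K + N) : ℝ) := by positivity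
    linarith
  intro m n hmn
  simp only [h1] at hmn
  exact pow_right_injective₀ (Real.exp_pos _) h2.ne (by exact_mod_cast hmn)

/-- If `φ^K = f` on a fixed point of the action, then `f = z ^ N`. -/
theorem eq_X_pow_of_phi_pow {K N : ℕ} [NeZero K] {E : FilteredHiggs K}
    (hgood : IsGoodAtInfinity K N E) (h : HiggsIso (E.act N 1) E) {f : ℂ[X]}
    (hf : ∀ s, (E.phi ^ K) s = f • s) : f = X ^ N := by
  obtain ⟨hmonic, hdeg⟩ := hgood.monic_of_phi_pow hf
  obtain ⟨T, hT, hphi⟩ := exists_semilinear_of_act h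
  set c := rotFactor K N 1 with hc
  set κ := Complex.exp 1 * c with hκ
  -- Here `T` lifts `ρ_1` to the sections. Evaluating `φ^K = f` on both sides of this identity shows
  -- that `f` equals `κ^K f(cz)`.
  have hpow : ∀ (k : ℕ) s, (E.phi ^ k) (T s) = C (κ ^ k) • T ((E.phi ^ k) s) := fun k => by
    induction k with
    | zero => simp
    | succ k ih =>
      intro s
      rw [pow_succ, Module.End.mul_apply, hphi, map_smul, ih, smul_smul, ← C_mul, ← pow_succ']
      rfl
  refine eq_X_pow_of_semiinvariant hmonic hdeg (rotFactor_one_pow_injective K N) (κ := κ ^ K) ?_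
  have e := Module.finBasisOfFinrankEq ℂ[X] E.Sec E.rank_eq
  obtain ⟨s, hs⟩ := T.surjective (e 0)
  have h1 := hpow K s
  rw [hf, hf, hT, smul_smul, hs] at h1
  have h2 := congrArg (fun v => e.repr v 0) h1
  simpa using h2

theorem exists_monomial_of_prod_eq {ι : Type*} [Fintype ι] {p : ι → ℂ[X]} {N : ℕ}
    (h : ∏ i, p i = X ^ N) :
    ∃ (b : ι → ℕ) (c : ι → ℂ), ∑ i, b i = N ∧ ∏ i, c i = 1 ∧ ∀ i, p i = C (c i) * X ^ b i := by
  have h1 : ∀ i, ∃ (n : ℕ) (c : ℂ), p i = C c * X ^ n := fun i => by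
    have h2 : p i ∣ X ^ N := h ▸ Finset.dvd_prod_of_mem p (Finset.mem_univ i)
    obtain ⟨n, -, u, hu⟩ := (dvd_prime_pow prime_X N).1 h2
    obtain ⟨c, -, hc⟩ := isUnit_iff.1 (u⁻¹).isUnit
    exact ⟨n, c, by rw [hc, ← hu, mul_left_comm, Units.inv_mul, mul_one]⟩
  choose b c hbc using h1
  have h2 : C (∏ i, c i) * X ^ (∑ i, b i) = (X ^ N : ℂ[X]) := by
    rw [← h, map_prod, ← Finset.prod_pow_eq_pow_sum, ← Finset.prod_mul_distrib]
    exact Finset.prod_congr rfl fun i _ => (hbc i).symm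
  have h3 : ∏ i, c i ≠ 0 := by
    intro h0
    rw [h0, C_0, zero_mul] at h2
    exact pow_ne_zero N X_ne_zero h2.symm
  refine ⟨b, c, ?_, ?_, hbc⟩
  · have := congrArg natDegree h2
    rwa [natDegree_C_mul_X_pow _ _ h3, natDegree_X_pow] at this
  · have := congrArg leadingCoeff h2
    rwa [leadingCoeff_C_mul_X_pow, leadingCoeff_X_pow] at this

/-- Going once round the cycle returns each basis vector, multiplied by all the entries. -/
theorem pow_apply_of_cyclic {R M : Type*} [CommRing R] [AddCommGroup M] [Module R M] {K : ℕ}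
    {e : Module.Basis (Fin K) R M} {φ : Module.End R M} {p : Fin K → R}
    (h : ∀ i, φ (e (finRotate K i)) = p i • e i) (s : M) : (φ ^ K) s = (∏ i, p i) • s := by
  have h1 : ∀ (k : ℕ) i, (φ ^ k) (e ((finRotate K ^ k) i)) =
      (∏ l ∈ Finset.range k, p ((finRotate K ^ l) i)) • e i := fun k i => by
    induction k with
    | zero => simp
    | succ k ih =>
      rw [pow_succ, pow_succ', Module.End.mul_apply, Equiv.Perm.mul_apply, h, map_smul, ih,
        Finset.prod_range_succ, smul_smul, mul_comm]
  have h2 : φ ^ K = LinearMap.lsmul R M (∏ i, p i) := e.ext fun i => by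
    have h3 := h1 K i
    rw [finRotate_pow_self, prod_finRotate_pow] at h3
    exact h3
  rw [h2]
  rfl

/-- Every fixed point is one of the `(ℰ_b, φ_b)`. -/
theorem exists_higgsIso_higgsOf {K N : ℕ} [NeZero K] (hKN : Nat.Coprime K N) (E : CObject K N)
    (hfix : ∀ t, HiggsIso (E.toFilteredHiggs.act N t) E.toFilteredHiggs) :
    ∃ b : OrderedPartition K N, HiggsIso E.toFilteredHiggs (higgsOf b) := by
  have hK0 : (K : ℂ) ≠ 0 := Nat.cast_ne_zero.2 (NeZero.ne K)
  have hKN0 : (K : ℂ) + N ≠ 0 := by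
    have := NeZero.pos K
    exact_mod_cast (by lia : K + N ≠ 0)
  -- This `t` is chosen so that `Kt/(K+N) = 2πi`: the rotation is trivial, but `e^t =
  -- exp(2πi(K+N)/K)` is a primitive `K`-th root of unity.
  set t : ℂ := 2 * Real.pi * Complex.I * ((K + N : ℕ) / K) with ht
  set κ := Complex.exp t with hκ
  have hprim : IsPrimitiveRoot κ K :=
    Complex.isPrimitiveRoot_exp_of_coprime (K + N) K (NeZero.ne K) (by simpa using hKN.symm)
  have hκ0 : κ ≠ 0 := Complex.exp_ne_zero _
  have hrot : rotFactor K N t = 1 := by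
    refine Units.ext ?_
    rw [rotFactor, Units.val_mk0, Units.val_one, Complex.exp_eq_one_iff]
    refine ⟨-1, ?_⟩
    rw [ht]
    push_cast
    field_simp
  obtain ⟨g, hginj, hgphi, hgfilt⟩ := exists_automorphism_of_act (hfix t) hrot
  obtain ⟨μ, hμ⟩ := exists_hasEigenvalue (E := E.toFilteredBundle) g (hgfilt 0)
  have hμ0 : μ ≠ 0 := by
    rintro rfl
    obtain ⟨v, hv⟩ := hμ.exists_hasEigenvector
    have h1 := hv.apply_eq_smul
    rw [C_0, zero_smul] at h1
    exact hv.2 (hginj (h1.trans (map_zero g).symm))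
  have hφeig : ∀ {ν : ℂ} {s : E.Sec}, g s = C ν • s → g (E.phi s) = C (ν * κ⁻¹) • E.phi s := by
    intro ν s hs
    have h1 := hgphi s
    rw [hs, map_smul] at h1
    rw [mul_comm, C_mul, mul_smul, h1, smul_smul, ← C_mul, inv_mul_cancel₀ hκ0, C_1, one_smul]
  have hpow : ∀ k : ℕ, Module.End.HasEigenvalue g (C (μ * κ⁻¹ ^ k)) := fun k => by
    induction k with
    | zero => simpa using hμ
    | succ k ih =>
      obtain ⟨v, hv⟩ := ih.exists_hasEigenvector
      refine Module.End.hasEigenvalue_of_hasEigenvector (x := E.phi v)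
        ⟨Module.End.mem_eigenspace_iff.2 ?_, fun h => hv.2 (E.good.phi_injective ?_)⟩
      · rw [hφeig hv.apply_eq_smul, mul_assoc, ← pow_succ]
      · rw [h, map_zero]
  set m : Fin K → ℂ := fun j => μ * κ ^ (j : ℕ) with hm
  have hminj : Function.Injective m := fun i j hij =>
    Fin.ext (hprim.pow_inj i.2 j.2 (mul_left_cancel₀ hμ0 hij))
  have hmrot : ∀ i, m (finRotate K i) * κ⁻¹ = m i := fun i => by
    obtain ⟨n, rfl⟩ : ∃ n, K = n + 1 := ⟨K - 1, by have := i.2; lia⟩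
    have h1 := val_finRotate_pow 1 i
    rw [pow_one] at h1
    simp only [hm]
    rw [h1, ← pow_eq_pow_mod _ hprim.pow_eq_one, pow_succ, mul_assoc, mul_assoc,
      mul_inv_cancel₀ hκ0, mul_one]
  -- Applying `φ` only divides eigenvalues by `κ`; the factor `κ^j` is reached as `κ^{-(K-j)}`.
  have hmeig : ∀ j, Module.End.HasEigenvalue g (C (m j)) := fun j => by
    have h1 := hpow (K - j)
    have h2 : κ⁻¹ ^ (K - j : ℕ) = κ ^ (j : ℕ) := by
      rw [inv_pow]
      refine inv_eq_of_mul_eq_one_right ?_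
      rw [← pow_add, Nat.sub_add_cancel j.2.le, hprim.pow_eq_one]
    rwa [h2] at h1
  obtain ⟨e, he⟩ := exists_eigenbasis_of_hasEigenvalue E.rank_eq hminj hmeig
  obtain ⟨a, ha⟩ := exists_isAdapted_of_eigenbasis (E := E.toFilteredBundle) hminj he hgfilt
  -- The eigenvalue of `φ e_{i+1}` is `m_{i+1} κ⁻¹ = m_i`, so only its coordinate along `e_i` can be
  -- nonzero.
  have hphi : ∀ i, E.phi (e (finRotate K i)) = e.repr (E.phi (e (finRotate K i))) i • e i := by
    intro i
    have h1 := hφeig (he (finRotate K i))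
    rw [hmrot] at h1
    set w := E.phi (e (finRotate K i))
    refine e.repr.injective (Finsupp.ext fun j => ?_)
    rw [map_smul, Finsupp.smul_apply, Module.Basis.repr_self, smul_eq_mul]
    by_cases hij : i = j
    · subst hij
      simp
    · have h2 : e.repr (g w) j = C (m j) * e.repr w j := by
        conv_lhs => rw [← e.sum_repr w]
        rw [map_sum, map_sum, Finset.sum_apply', Finset.sum_eq_single j]
        · rw [map_smul, he, map_smul, map_smul, Module.Basis.repr_self]
          simp [mul_comm]
        · intro l _ hl
          rw [map_smul, he, map_smul, map_smul, Module.Basis.repr_self]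
          simp [hl]
        · simp
      rw [h1, map_smul, Finsupp.smul_apply, smul_eq_mul] at h2
      have h3 : C (m i - m j) * e.repr w j = 0 := by
        rw [C_sub]
        linear_combination h2
      rw [Finsupp.single_eq_of_ne (Ne.symm hij), mul_zero]
      exact (mul_eq_zero.1 h3).resolve_left
        (C_ne_zero.2 (sub_ne_zero.2 fun h => hij (hminj h)))
  have hprod := eq_X_pow_of_phi_pow E.good (hfix 1) (pow_apply_of_cyclic hphi)
  obtain ⟨b, c, hb, hc, hbc⟩ := exists_monomial_of_prod_eq hprod
  have hphi' : ∀ i, E.phi (e (finRotate K i)) = (C (c i) * X ^ b i) • e i := fun i => by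
    rw [← hbc]
    exact hphi i
  have hc0 : ∀ i, c i ≠ 0 := fun i =>
    Finset.prod_ne_zero_iff.1 (hc ▸ one_ne_zero) i (Finset.mem_univ i)
  have hab : a = parDeg (⟨b, hb⟩ : OrderedPartition K N) :=
    eq_parDeg _ (fun i => E.good.sub_eq ha (hc0 i) (hphi' i)) (sum_eq_zero_of_slStructure ha E.sl)
  rw [hab] at ha
  exact ⟨⟨b, hb⟩, higgsIso_higgsOf ha hc hphi'⟩

end WildHiggs

/-! ### The bijection and the strata -/

theorem proposition3p3 (K N : ℕ) [NeZero K] (hK : 2 ≤ K) (hN : 0 < N) (hKN : Nat.Coprime K N) :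
    ∃ F : WildHiggs.CyclicPartition K N → WildHiggs.HiggsClass K,
      (∀ b : WildHiggs.OrderedPartition K N, F ⟦b⟧ = ⟦WildHiggs.higgsOf b⟧) ∧
      Set.BijOn F Set.univ (WildHiggs.fixedPoints K N) ∧
      (WildHiggs.fixedPoints K N).Finite ∧
      ∀ p : WildHiggs.CyclicPartition K N,
        WildHiggs.fixedPoints K N ∩ WildHiggs.stratum p = {F p} := by
  set F : WildHiggs.CyclicPartition K N → WildHiggs.HiggsClass K :=
    Quotient.map WildHiggs.higgsOf fun _ _ h => WildHiggs.higgsIso_of_cyclic h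
  have hF : ∀ b : WildHiggs.OrderedPartition K N, F ⟦b⟧ = ⟦WildHiggs.higgsOf b⟧ := fun b => rfl
  have hsurj : ∀ q ∈ WildHiggs.fixedPoints K N, ∃ b : WildHiggs.OrderedPartition K N,
      (⟦WildHiggs.higgsOf b⟧ : WildHiggs.HiggsClass K) = q := by
    rintro q ⟨⟨E, rfl⟩, hq⟩
    obtain ⟨b, hb⟩ := WildHiggs.exists_higgsIso_higgsOf hKN E fun t => Quotient.exact (hq t)
    exact ⟨b, (Quotient.sound hb).symm⟩
  have hbij : Set.BijOn F Set.univ (WildHiggs.fixedPoints K N) := by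
    refine ⟨fun p _ => ?_, fun p _ p' _ h => ?_, fun q hq => ?_⟩
    · induction p using Quotient.inductionOn with
      | h b => exact WildHiggs.higgsOf_mem_fixedPoints hK b
    · induction p using Quotient.inductionOn with
      | h b =>
        induction p' using Quotient.inductionOn with
        | h b' =>
          obtain ⟨g, hg, -⟩ := Quotient.exact h
          exact Quotient.sound (WildHiggs.cyclic_of_isFilteredIso hKN hg)
    · obtain ⟨b, hb⟩ := hsurj q hq
      exact ⟨⟦b⟧, trivial, hb⟩
  refine ⟨F, hF, hbij, hbij.image_eq ▸ Set.toFinite _, fun p => ?_⟩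
  ext q
  rw [Set.mem_singleton_iff]
  constructor
  · rintro ⟨hq, -, b, E, rfl, rfl, g, hg⟩
    obtain ⟨b', hb'⟩ := hsurj _ hq
    obtain ⟨g', hg', -⟩ := Quotient.exact hb'
    rw [← hb', ← hF b']
    -- The fixed point is the class of some `b'`, and composing the two filtered isomorphisms
    -- identifies `⨁ 𝒪(α'_i)` with `⨁ 𝒪(α_i)`, so `b'` and `b` are cyclically equivalent.
    exact congrArg F (Quotient.sound (WildHiggs.cyclic_of_isFilteredIso hKN (hg'.trans hg)))
  · rintro rfl
    have hp := hbij.mapsTo (Set.mem_univ p)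
    induction p using Quotient.inductionOn with
    | h b =>
      exact ⟨hp, hp.1, b, WildHiggs.higgsOf b, rfl, rfl, LinearEquiv.refl _ _,
        WildHiggs.IsFilteredIso.refl _⟩
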